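/- **Corollary (Energy equality).** Let $\Omega\subset\mathbb R^2$ be open (for instance a bounded Lipschitz domain), let $T>0$, $\mu>0$, $\tau_y\ge 0$. Let $H=\{v\in L^2(\Omega;\mathbb R^2):\nabla\cdot v=0,\ v\cdot n|_{\partial\Omega}=0\}$ (both conditions in the weak sense, i.e. $\int_\Omega v\cdot\nabla q=0$ for all $q\in H^1(\Omega)$) with the $L^2$ norm, and $V=\{v\in H^1_0(\Omega;\mathbb R^2):\nabla\cdot v=0\}$ with the $H^1$ norm; let $V'$ be the dual of $V$, $\langle\cdot,\cdot\rangle$ the duality bracket, and embed $V$ into $V'$ by means of the $L^2$ scalar product. Write $Dv=\frac12(\nabla v+\nabla v^t)$, $A:B=\sum_{i,j}A_{ij}B_{ij}$, $|A|^2=A:A$. Let $f\in L^2(0,T;V')$ and $u_0\in H$. Let $(u,\tau(Du))$ be a weak solution of the Navier–Stokes equations for a homogeneous incompressible Bingham fluid with force $f$ and initial velocity $u_0$, that is: $u\in L^2(0,T;V)$ with $\partial_t u\in L^2(0,T;V')$; $\tau(Du)\in L^2(\Omega\times(0,T);\mathbb R^{2\times 2})$ satisfies, almost everywhere in $\Omega\times(0,T)$,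 $\tau(Du)=\bigl(2\mu+\frac{\tau_y}{|Du|}\bigr)Du$ where $Du\ne0$ and $|\tau(Du)|\le\tau_y$ where $Du=0$; $u(0)=u_0$, in the sense that $u(t)\to u_0$ weakly in $H$ as $t\to0^+$ outside some null set of times; and for all $\varphi\in L^2(0,T;V)$ $$\int_0^T\langle\partial_tu,\varphi\rangle\,dt+\int_0^T\!\!\int_\Omega\tau(Du):D\varphi\,dx\,dt+\int_0^T\!\!\int_\Omega(u\cdot\nabla)u\cdot\varphi\,dx\,dt=\int_0^T\langle f,\varphi\rangle\,dt .$$ Then $u\in C^0([0,T];H)$, i.e. $u$ coincides for almost every $t\in(0,T)$ with a continuous function $[0,T]\to H$, again denoted by $u$, and $u(0)=u_0$. Moreover $t\mapsto\int_\Omega\tau(Du(t)):Du(t)\,dx$ and $t\mapsto\langle f(t),u(t)\rangle$ are integrable on $(0,T)$, and for all $s_1,s_2\in[0,T]$ $$\frac12\|u(s_2)\|_{L^2(\Omega)}^2+\int_{s_1}^{s_2}\!\!\int_\Omega\tau(Du):Du\,dx\,dt=\int_{s_1}^{s_2}\langle f,u\rangle\,dt+\frac12\|u(s_1)\|_{L^2(\Omega)}^2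 .$$ -/

import Mathlib

open MeasureTheory Set Filter Topology
open scoped ContDiff

namespace BinghamFlow

noncomputable section

/-- The plane `ℝ²` with its Euclidean norm. -/
abbrev Plane : Type := EuclideanSpace ℝ (Fin 2)

/-- Real `2 × 2` matrices with the scalar product `A : B = ∑ i j, A i j * B i j`, so that the norm
is `|A| = (A : A) ^ (1 / 2)`. -/
abbrev Tensor : Type := EuclideanSpace ℝ (Fin 2 × Fin 2)

/-- `L²(Ω; ℝ²)`. -/
abbrev L2Vec (Ω : Set Plane) : Type := Lp Plane 2 (volume.restrict Ω)

/-- `L²(Ω; ℝ^{2 × 2})`. -/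
abbrev L2Ten (Ω : Set Plane) : Type := Lp Tensor 2 (volume.restrict Ω)

/-- The Jacobian matrix of a vector field, with entries `∂ⱼ φᵢ` at `(i, j)`. -/
def jacobian (φ : Plane → Plane) (x : Plane) : Tensor :=
  WithLp.toLp 2 fun ij => (fderiv ℝ φ x (EuclideanSpace.single ij.2 1)) ij.1

/-- The symmetric part `(A + Aᵀ) / 2`. -/
def symPart (A : Tensor) : Tensor :=
  WithLp.toLp 2 fun ij => (A (ij.1, ij.2) + A (ij.2, ij.1)) / 2

/-- The ambient Hilbert space of pairs (field, gradient field), with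
`‖(v, G)‖² = ‖v‖² + ‖G‖²` (the norm of `H¹(Ω; ℝ²)` on pairs `(v, ∇v)`). -/
abbrev L2Pair (Ω : Set Plane) : Type := WithLp 2 (L2Vec Ω × L2Ten Ω)

/-- The pairs `(φ, ∇φ)` with `φ ∈ C_c^∞(Ω; ℝ²)`. -/
def testPairs (Ω : Set Plane) : Set (L2Pair Ω) :=
  {p | ∃ φ : Plane → Plane, ContDiff ℝ ∞ φ ∧ HasCompactSupport φ ∧ tsupport φ ⊆ Ω ∧
    (p.fst =ᵐ[volume.restrict Ω] φ) ∧ (p.snd =ᵐ[volume.restrict Ω] jacobian φ)}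

/-- `H¹₀(Ω; ℝ²)`, the closure of `C_c^∞(Ω; ℝ²)` in the `H¹` norm. An element is stored as the pair
`(v, ∇v)`. -/
def H10 (Ω : Set Plane) : Submodule ℝ (L2Pair Ω) :=
  (Submodule.span ℝ (testPairs Ω)).topologicalClosure

/-- The pairs `(v, G)` with `G₁₁ + G₂₂ = 0` almost everywhere in `Ω`. -/
def traceFree (Ω : Set Plane) : Submodule ℝ (L2Pair Ω) where
  carrier := {p | ∀ᵐ x ∂(volume.restrict Ω), ∑ i, p.snd x (i, i) = 0}
  zero_mem' := by
    filter_upwards [Lp.coeFn_zero Tensor 2 (volume.restrict Ω)] with x hx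
    have h4 : (0 : L2Pair Ω).snd x = 0 := hx
    simp only [h4, PiLp.zero_apply, Finset.sum_const_zero]
  add_mem' := by
    intro p q hp hq
    filter_upwards [hp, hq, Lp.coeFn_add p.snd q.snd] with x h1 h2 h3
    have h4 : (p + q).snd x = p.snd x + q.snd x := h3
    simp only [h4, PiLp.add_apply, Finset.sum_add_distrib, h1, h2, add_zero]
  smul_mem' := by
    intro c p hp
    filter_upwards [hp, Lp.coeFn_smul c p.snd] with x h1 h3
    have h4 : (c • p).snd x = c • p.snd x := h3
    simp only [h4, PiLp.smul_apply, smul_eq_mul, ← Finset.mul_sum, h1, mul_zero]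

/-- `V = {v ∈ H¹₀(Ω; ℝ²) : ∇ · v = 0}` with the `H¹` norm. -/
def V (Ω : Set Plane) : Submodule ℝ (L2Pair Ω) := H10 Ω ⊓ traceFree Ω

/-- The topological dual `V'`. -/
abbrev VDual (Ω : Set Plane) : Type := StrongDual ℝ (V Ω)

/-- The field `v ∈ L²(Ω; ℝ²)` underlying an element of `V`. -/
def field {Ω : Set Plane} (v : V Ω) : L2Vec Ω := (v : L2Pair Ω).fst

/-- The gradient `∇v ∈ L²(Ω; ℝ^{2 × 2})` of an element of `V`. -/
def grad {Ω : Set Plane} (v : V Ω) : L2Ten Ω := (v : L2Pair Ω).snd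

/-- The strain tensor `Dv = (∇v + ∇vᵀ) / 2`. -/
def strain {Ω : Set Plane} (v : V Ω) (x : Plane) : Tensor := symPart (grad v x)

/-- The fields `∇q`, where `q ∈ C^∞(Ω) ∩ H¹(Ω)`; these functions `q` are dense in `H¹(Ω)` for
every open `Ω`. -/
def gradients (Ω : Set Plane) : Set (L2Vec Ω) :=
  {g | ∃ q : Plane → ℝ, ContDiffOn ℝ ∞ q Ω ∧ MemLp q 2 (volume.restrict Ω) ∧
    g =ᵐ[volume.restrict Ω] gradient q}

/-- `H = {v ∈ L²(Ω; ℝ²) : ∇ · v = 0, v · n = 0 on ∂Ω}`, where the two conditions are read in the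
weak sense, that is, as `∫_Ω v · ∇q = 0` for all `q ∈ H¹(Ω)`: the functions `q ∈ C_c^∞(Ω)` express
`∇ · v = 0`, and then `q ↦ ∫_Ω v · ∇q` is the normal trace of `v`. -/
def H (Ω : Set Plane) : Submodule ℝ (L2Vec Ω) := (Submodule.span ℝ (gradients Ω))ᗮ

/-- The embedding `V → V'` given by the scalar product of `L²(Ω; ℝ²)`: `v ↦ (z ↦ ∫_Ω v · z)`. -/
def toDual {Ω : Set Plane} (v : V Ω) : VDual Ω :=
  (innerSL ℝ (field v)).comp ((WithLp.fstL 2 ℝ (L2Vec Ω) (L2Ten Ω)).comp (V Ω).subtypeL)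

/-- `g ∈ L²(0, T; X)`. -/
def MemL2Time {X : Type*} [NormedAddCommGroup X] (T : ℝ) (g : ℝ → X) : Prop :=
  MemLp g 2 (volume.restrict (Ioo 0 T))

/-- `w ∈ L²(0, T; V')` is the distributional time derivative `∂ₜu` of `u ∈ L²(0, T; V)`;
in particular `u ∈ E_{2,2}(V)`. -/
structure HasTimeDeriv {Ω : Set Plane} (T : ℝ) (u : ℝ → V Ω) (w : ℝ → VDual Ω) : Prop where
  memL2 : MemL2Time T u
  memL2_deriv : MemL2Time T w
  deriv_eq : ∀ η : ℝ → ℝ, ContDiff ℝ ∞ η → HasCompactSupport η → tsupport η ⊆ Ioo 0 T →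
    ∫ t in 0..T, deriv η t • toDual (u t) = -∫ t in 0..T, η t • w t

/-- The Bingham law relating a stress `σ` and a strain `A`, with viscosity `μ` and yield stress
`τy`. -/
def IsBinghamStress (μ τy : ℝ) (σ A : Tensor) : Prop :=
  (A ≠ 0 → σ = (2 * μ + τy / ‖A‖) • A) ∧ (A = 0 → ‖σ‖ ≤ τy)

/-- `∫_Ω (a · ∇) b · c`. -/
def convection {Ω : Set Plane} (a b c : V Ω) : ℝ :=
  ∫ x in Ω, ∑ i, (∑ j, field a x j * grad b x (i, j)) * field c x i

/-- `∫_Ω σ : Dv`. -/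
def stressPower {Ω : Set Plane} (σ : Plane → Tensor) (v : V Ω) : ℝ :=
  ∫ x in Ω, inner ℝ (σ x) (strain v x)

/-- `(u, τ)` is a weak solution of the Bingham problem on `Ω × (0, T)` with force `f` and initial
velocity `u₀`. The initial condition is `u(t) → u₀` weakly in `H` as `t → 0+`, up to a null set of
times; no continuity of `u` is presupposed. -/
structure IsWeakSolution {Ω : Set Plane} (T μ τy : ℝ) (f : ℝ → VDual Ω) (u₀ : H Ω)
    (u : ℝ → V Ω) (τ : ℝ → Plane → Tensor) : Prop where
  stress_memL2 : MemLp (fun z : ℝ × Plane => τ z.1 z.2) 2 (volume.restrict (Ioo 0 T ×ˢ Ω))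
  bingham : ∀ᵐ t ∂(volume.restrict (Ioo 0 T)), ∀ᵐ x ∂(volume.restrict Ω),
    IsBinghamStress μ τy (τ t x) (strain (u t) x)
  initial : ∀ h : H Ω, Tendsto (fun t => inner ℝ (field (u t)) (h : L2Vec Ω))
    (𝓝[>] (0 : ℝ) ⊓ ae volume) (𝓝 (inner ℝ (u₀ : L2Vec Ω) (h : L2Vec Ω)))
  weak_form : ∃ w : ℝ → VDual Ω, HasTimeDeriv T u w ∧ ∀ φ : ℝ → V Ω, MemL2Time T φ →
    (∫ t in 0..T, w t (φ t)) + (∫ t in 0..T, stressPower (τ t) (φ t))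
      + (∫ t in 0..T, convection (u t) (u t) (φ t)) = ∫ t in 0..T, f t (φ t)

end

end BinghamFlow

/-! The energy equality comes from testing the weak formulation with `u` cut off to the time
interval between `s₁` and `s₂`; this is admissible because test functions need only be `L²` in time
with values in `V`. Two facts turn the result into the claim.

The first is the Lions–Magenes theorem, `exists_continuous_representative`, for an abstract map `j :
X → Y` into a pivot space. The functional `⟪j u, j ·⟫` is a.e. a primitive of `w = ∂ₜu` (du
Bois-Reymond). Pairing its increment from `r` to `r + h` with `u(r + h) + u(r)` produces exactly `‖j
u(r + h)‖² - ‖j u(r)‖²`. Integrating over `r`, dividing by `h` and letting `h → 0` gives `‖j u(t)‖²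
- ‖j u(s)‖² = 2 ∫ ⟨w, u⟩` at almost all times, by continuity of translations in `L²`. The same
identity bounds `‖j u(t) - j u(s)‖²` by an increment of a continuous function, so `j u` extends
continuously to `[0, T]` and the identity extends with it.

The second is `convection_self`: `∫ (v · ∇)v · v = 0` on `V`. For a test field `φ`, `∫ (v · ∇)φ · φ
= ½ ∫ v · ∇|φ|²` vanishes because `V` is orthogonal to gradients. Ladyzhenskaya's inequality in the
plane gives `H¹₀ ⊆ L⁴`, which allows the passage `φ → v`.

Since `H` is closed and contains the fields of `V`, the continuous representative stays in `H`. Its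
value at `0` is `u₀`, weak limits being unique. -/

namespace BinghamFlow

/-! ### Weak derivatives in time -/

section

theorem exists_Icc_of_isCompact_subset_Ioo {K : Set ℝ} (hK : IsCompact K) {T : ℝ} (hT : 0 < T)
    (hKT : K ⊆ Ioo 0 T) : ∃ a b, 0 < a ∧ a < b ∧ b < T ∧ K ⊆ Icc a b := by
  rcases K.eq_empty_or_nonempty with rfl | hne
  · exact ⟨T / 3, T / 2, by linarith, by linarith, by linarith, empty_subset _⟩
  obtain ⟨m, hm, hm'⟩ := hK.exists_isLeast hne
  obtain ⟨M, hM, hM'⟩ := hK.exists_isGreatest hne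
  have h1 := hKT hm
  have h2 := hKT hM
  refine ⟨m / 2, (M + T) / 2, by linarith [h1.1], ?_, by linarith [h2.2], fun x hx => ⟨?_, ?_⟩⟩
  · linarith [h1.1, h2.2, hm' hM]
  · linarith [h1.1, hm' hx]
  · linarith [h2.2, hM' hx]

/-- A test function of zero mean has a primitive which is a test function. -/
theorem exists_primitive_of_integral_eq_zero {T : ℝ} (hT : 0 < T) {ψ : ℝ → ℝ}
    (hψ : ContDiff ℝ ∞ ψ) (hc : HasCompactSupport ψ) (hs : tsupport ψ ⊆ Ioo 0 T)
    (h0 : ∫ t in 0..T, ψ t = 0) :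
    ∃ η : ℝ → ℝ, ContDiff ℝ ∞ η ∧ HasCompactSupport η ∧ tsupport η ⊆ Ioo 0 T ∧ deriv η = ψ := by
  obtain ⟨a, b, ha, hab, hb, hK⟩ := exists_Icc_of_isCompact_subset_Ioo hc hT hs
  have hzero : ∀ t, t ∉ Icc a b → ψ t = 0 := fun t ht =>
    image_eq_zero_of_notMem_tsupport fun h => ht (hK h)
  have hcont : Continuous ψ := hψ.continuous
  have hder : ∀ t, HasDerivAt (fun t => ∫ s in 0..t, ψ s) (ψ t) t := fun t =>
    intervalIntegral.integral_hasDerivAt_right (hcont.intervalIntegrable _ _)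
      (hcont.stronglyMeasurableAtFilter _ _) hcont.continuousAt
  have hd : deriv (fun t => ∫ s in 0..t, ψ s) = ψ := funext fun t => (hder t).deriv
  have hsupp : Function.support (fun t => ∫ s in 0..t, ψ s) ⊆ Icc a b := by
    intro t ht
    by_contra hn
    refine ht ?_
    rw [mem_Icc, not_and_or, not_le, not_le] at hn
    rcases hn with hn | hn
    · refine intervalIntegral.integral_zero_ae (Eventually.of_forall fun s hs => hzero s fun h => ?_)
      rcases mem_uIoc.1 hs with h' | h' <;> linarith [h.1, h'.2, h'.1]
    -- Beyond the support the primitive equals the total integral of `ψ`, which is zero; this is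
    -- where the zero mean enters.
    · have h1 : ∫ s in t..T, ψ s = 0 := by
        refine intervalIntegral.integral_zero_ae
          (Eventually.of_forall fun s hs => hzero s fun h => ?_)
        rcases mem_uIoc.1 hs with h' | h' <;> linarith [h.2, h'.2, h'.1]
      have h2 := intervalIntegral.integral_add_adjacent_intervals
        (hcont.intervalIntegrable (μ := volume) 0 t) (hcont.intervalIntegrable t T)
      change ∫ s in 0..t, ψ s = 0
      linarith
  have hts : tsupport (fun t => ∫ s in 0..t, ψ s) ⊆ Icc a b := closure_minimal hsupp isClosed_Icc
  refine ⟨_, contDiff_infty_iff_deriv.2 ⟨fun t => (hder t).differentiableAt, by rwa [hd]⟩,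
    isCompact_Icc.of_isClosed_subset (isClosed_tsupport _) hts, fun t ht => ?_, hd⟩
  exact ⟨ha.trans_le (hts ht).1, (hts ht).2.trans_lt hb⟩

variable {E : Type*} [NormedAddCommGroup E] [NormedSpace ℝ E]

/-- Integration by parts of a primitive against a test function. -/
theorem integral_deriv_smul_primitive [CompleteSpace E] {T : ℝ} (hT : 0 < T) {w : ℝ → E}
    (hw : IntervalIntegrable w volume 0 T) {η : ℝ → ℝ} (hη : ContDiff ℝ ∞ η)
    (hηT : η T = 0) :
    ∫ t in 0..T, deriv η t • ∫ s in 0..t, w s = -∫ t in 0..T, η t • w t := by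
  have hdc : Continuous (deriv η) := hη.continuous_deriv (by simp)
  have hwi : Integrable w (volume.restrict (Ioc 0 T)) := hw.1
  have hdi : Integrable (deriv η) (volume.restrict (Ioc 0 T)) :=
    (hdc.intervalIntegrable (μ := volume) 0 T).1
  -- Fubini on the triangle `s ≤ t`. The primitive vanishes at `0`, so the only boundary value to
  -- remove is `η T`.
  set S : Set (ℝ × ℝ) := {z | z.2 ≤ z.1} with hS
  have hSm : MeasurableSet S := measurableSet_le measurable_snd measurable_fst
  set F : ℝ → ℝ → E := fun t s => S.indicator (fun z => deriv η z.1 • w z.2) (t, s) with hF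
  have hFi : Integrable (Function.uncurry F)
      ((volume.restrict (Ioc 0 T)).prod (volume.restrict (Ioc 0 T))) :=
    (hdi.smul_prod hwi).indicator hSm
  have hswap := integral_integral_swap hFi
  have hleft : ∀ t ∈ Ioc 0 T, ∫ s in Ioc 0 T, F t s = deriv η t • ∫ s in 0..t, w s := by
    intro t ht
    have h1 : F t = (Iic t).indicator (fun s => deriv η t • w s) := by
      ext s; simp only [hF, hS, indicator, mem_ofPred_eq, mem_Iic]
    rw [h1, setIntegral_indicator measurableSet_Iic, integral_smul,
      intervalIntegral.integral_of_le ht.1.le, Ioc_inter_Iic, min_eq_right ht.2]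
  have hright : ∀ s ∈ Ioc 0 T, ∫ t in Ioc 0 T, F t s = -(η s • w s) := by
    intro s hs
    have h1 : (fun t => F t s) = (Ici s).indicator (fun t => deriv η t • w s) := by
      ext t; simp only [hF, hS, indicator, mem_ofPred_eq, mem_Ici]
    have h2 : Ioc 0 T ∩ Ici s = Icc s T := by
      ext x; simp only [mem_inter_iff, mem_Ioc, mem_Ici, mem_Icc]
      exact ⟨fun h => ⟨h.2, h.1.2⟩, fun h => ⟨⟨hs.1.trans_le h.1, h.2⟩, h.1⟩⟩
    rw [h1, setIntegral_indicator measurableSet_Ici, integral_smul_const, h2,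
      integral_Icc_eq_integral_Ioc, ← intervalIntegral.integral_of_le hs.2,
      intervalIntegral.integral_deriv_eq_sub (fun x _ => (hη.differentiable (by simp)) x)
        (hdc.intervalIntegrable _ _), hηT, zero_sub, neg_smul]
  rw [setIntegral_congr_fun measurableSet_Ioc hleft,
    setIntegral_congr_fun measurableSet_Ioc hright, integral_neg] at hswap
  rw [intervalIntegral.integral_of_le hT.le, intervalIntegral.integral_of_le hT.le]
  exact hswap

theorem integral_smul_eq_of_tsupport_subset_Ioo {T : ℝ} (hT : 0 < T) {g : ℝ → ℝ} {k : ℝ → E}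
    (hg : tsupport g ⊆ Ioo 0 T) : ∫ t in 0..T, g t • k t = ∫ t, g t • k t := by
  rw [intervalIntegral.integral_of_le hT.le]
  refine setIntegral_eq_integral_of_forall_compl_eq_zero fun x hx => ?_
  rw [image_eq_zero_of_notMem_tsupport fun h' => hx ⟨(hg h').1, (hg h').2.le⟩, zero_smul]

/-- A function whose weak derivative is integrable is almost everywhere a primitive of it. -/
theorem exists_ae_eq_const_add_integral [CompleteSpace E] {T : ℝ} (hT : 0 < T) {F w : ℝ → E}
    (hF : IntervalIntegrable F volume 0 T) (hw : IntervalIntegrable w volume 0 T)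
    (h : ∀ η : ℝ → ℝ, ContDiff ℝ ∞ η → HasCompactSupport η → tsupport η ⊆ Ioo 0 T →
      ∫ t in 0..T, deriv η t • F t = -∫ t in 0..T, η t • w t) :
    ∃ c : E, ∀ᵐ t, t ∈ Ioo 0 T → F t = c + ∫ s in 0..t, w s := by
  set D : ℝ → E := fun t => F t - ∫ s in 0..t, w s with hD
  have hWc : ContinuousOn (fun t => ∫ s in 0..t, w s) (uIcc 0 T) :=
    intervalIntegral.continuousOn_primitive_interval (by rwa [← intervalIntegrable_iff'])
  have hWi : IntervalIntegrable (fun t => ∫ s in 0..t, w s) volume 0 T := hWc.intervalIntegrable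
  have hDi : IntervalIntegrable D volume 0 T := hF.sub hWi
  have hmul : ∀ (g : ℝ → ℝ) (G : ℝ → E), Continuous g → IntervalIntegrable G volume 0 T →
      IntervalIntegrable (fun t => g t • G t) volume 0 T := fun g G hg hG =>
    hG.continuousOn_smul hg.continuousOn
  have hDη : ∀ η : ℝ → ℝ, ContDiff ℝ ∞ η → HasCompactSupport η → tsupport η ⊆ Ioo 0 T →
      ∫ t in 0..T, deriv η t • D t = 0 := by
    intro η h1 h2 h3
    have hc : Continuous (deriv η) := h1.continuous_deriv (by simp)
    have hηT : η T = 0 := image_eq_zero_of_notMem_tsupport fun hT' => lt_irrefl _ (h3 hT').2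
    simp only [hD, smul_sub]
    rw [intervalIntegral.integral_sub (hmul _ _ hc hF) (hmul _ _ hc hWi), h η h1 h2 h3,
      integral_deriv_smul_primitive hT hw h1 hηT, sub_self]
  -- A fixed test function of integral one. The constant is then `c = ∫ ρ D`, as it must be if `D`
  -- is constant.
  let ρ₀ : ContDiffBump (T / 2) := ⟨T / 8, T / 4, by linarith, by linarith⟩
  set ρ : ℝ → ℝ := ρ₀.normed volume with hρ
  have hρd : ContDiff ℝ ∞ ρ := ρ₀.contDiff_normed
  have hρc : HasCompactSupport ρ := ρ₀.hasCompactSupport_normed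
  have hρs : tsupport ρ ⊆ Ioo 0 T := by
    rw [hρ, ρ₀.tsupport_normed_eq, Real.closedBall_eq_Icc]
    intro x hx
    exact ⟨by linarith [hx.1, show ρ₀.rOut = T / 4 from rfl],
      by linarith [hx.2, show ρ₀.rOut = T / 4 from rfl]⟩
  have hρ1 : ∫ t in 0..T, ρ t = 1 := by
    have := integral_smul_eq_of_tsupport_subset_Ioo hT (k := fun _ => (1 : ℝ)) hρs
    simp only [smul_eq_mul, mul_one] at this
    rw [this]; exact ρ₀.integral_normed
  refine ⟨∫ t in 0..T, ρ t • D t, ?_⟩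
  set c := ∫ t in 0..T, ρ t • D t with hc
  have hloc : LocallyIntegrableOn (fun t => D t - c) (Ioo 0 T) volume := by
    refine IntegrableOn.locallyIntegrableOn ?_
    have := (hDi.sub (intervalIntegrable_const (c := c))).1
    exact this.mono_set Ioo_subset_Ioc_self
  have := isOpen_Ioo.ae_eq_zero_of_integral_contDiff_smul_eq_zero hloc (fun g hg hgc hgs => by
    rw [← integral_smul_eq_of_tsupport_subset_Ioo hT hgs]
    set m := ∫ t in 0..T, g t with hm
    -- Removing `m ρ` makes the mean of `g` zero, so the difference is the derivative of a test
    -- function and `D` annihilates it. Hence `∫ g D = m c = ∫ g c`.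
    obtain ⟨η, h1, h2, h3, h4⟩ := exists_primitive_of_integral_eq_zero hT
      (ψ := fun t => g t - m * ρ t) (hg.sub (contDiff_const.mul hρd))
      (hgc.sub (hρc.mul_left (f := fun _ => m)))
      ((tsupport_sub _ _).trans (union_subset hgs
        ((tsupport_mul_subset_right (f := fun _ => m) (g := ρ)).trans hρs))) (by
        have hmρ : IntervalIntegrable (fun t => m * ρ t) volume 0 T :=
          (continuous_const.mul hρd.continuous).intervalIntegrable _ _
        rw [intervalIntegral.integral_sub (hg.continuous.intervalIntegrable _ _) hmρ,
          intervalIntegral.integral_const_mul, hρ1, mul_one, sub_self])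
    have h5 := hDη η h1 h2 h3
    rw [h4] at h5
    simp only [sub_smul, mul_smul, smul_sub] at h5 ⊢
    have hmρ : IntervalIntegrable (fun t => m • ρ t • D t) volume 0 T :=
      (hmul _ _ hρd.continuous hDi).smul m
    rw [intervalIntegral.integral_sub (hmul _ _ hg.continuous hDi) hmρ,
      intervalIntegral.integral_smul] at h5
    rw [intervalIntegral.integral_sub (hmul _ _ hg.continuous hDi)
      (hmul _ _ hg.continuous intervalIntegrable_const), intervalIntegral.integral_smul_const]
    exact h5)
  filter_upwards [this] with t ht htT
  have := ht htT
  rw [hD, sub_sub, sub_eq_zero] at this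
  rw [this, add_comm]

end

/-! ### Energy identity at Lebesgue points -/

section

variable {E : Type*} [NormedAddCommGroup E] [NormedSpace ℝ E]

theorem intervalIntegrable_of_memLp_two {E : Type*} [NormedAddCommGroup E] {a : ℝ → E}
    (ha : MemLp a 2 volume) (x y : ℝ) : IntervalIntegrable a volume x y :=
  intervalIntegrable_iff.2 (((ha.locallyIntegrable (by norm_num)).integrableOn_isCompact
    isCompact_uIcc).mono_set uIoc_subset_uIcc)

/-- The translates of an `L²` function depend continuously on the shift. -/
theorem exists_continuous_translate {f : ℝ → E} (hf : MemLp f 2 volume) (S : Set ℝ) :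
    ∃ A : ℝ → Lp E 2 (volume.restrict S), Continuous A ∧
      ∀ σ, A σ =ᵐ[volume.restrict S] fun r => f (r + σ) := by
  let g : C(ℝ, C(ℝ, ℝ)) := ContinuousMap.curry ⟨fun z : ℝ × ℝ => z.2 + z.1, by fun_prop⟩
  have hg : ∀ σ, MeasurePreserving (g σ) volume volume := fun σ =>
    measurePreserving_add_right volume σ
  refine ⟨fun σ => LpToLpRestrictCLM ℝ E ℝ volume 2 S
    (Lp.compMeasurePreserving (g σ) (hg σ) hf.toLp), ?_, fun σ => ?_⟩
  · exact (ContinuousLinearMap.continuous _).comp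
      (continuous_const.compMeasurePreservingLp g.continuous hg (by simp))
  · refine (LpToLpRestrictCLM_coeFn ℝ S _).trans (ae_restrict_of_ae ?_)
    refine (Lp.coeFn_compMeasurePreserving _ _).trans ?_
    exact (hg σ).quasiMeasurePreserving.ae_eq_comp hf.coeFn_toLp

theorem tendsto_inv_mul_integral_of_continuous {Φ : ℝ × ℝ → ℝ} (hΦ : Continuous Φ) :
    Tendsto (fun h => h⁻¹ * ∫ σ in 0..h, Φ (σ, h)) (𝓝[>] 0) (𝓝 (Φ (0, 0))) := by
  rw [Metric.tendsto_nhds]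
  intro ε hε
  obtain ⟨δ, hδ, hδ'⟩ := Metric.continuous_iff.1 hΦ (0, 0) (ε / 2) (half_pos hε)
  filter_upwards [Ioo_mem_nhdsGT hδ] with h hh
  have hi : IntervalIntegrable (fun σ => Φ (σ, h)) volume 0 h :=
    (hΦ.comp (by fun_prop)).intervalIntegrable _ _
  have h1 : h⁻¹ * (∫ σ in 0..h, Φ (σ, h)) - Φ (0, 0)
      = h⁻¹ * ∫ σ in 0..h, (Φ (σ, h) - Φ (0, 0)) := by
    rw [intervalIntegral.integral_sub hi intervalIntegrable_const, intervalIntegral.integral_const]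
    have := hh.1.ne'
    simp only [sub_zero, smul_eq_mul]
    field_simp
  have h2 : ‖∫ σ in 0..h, (Φ (σ, h) - Φ (0, 0))‖ ≤ ε / 2 * |h - 0| := by
    refine intervalIntegral.norm_integral_le_of_norm_le_const fun σ hσ => ?_
    rw [uIoc_of_le hh.1.le] at hσ
    refine (hδ' (σ, h) ?_).le
    rw [Prod.dist_eq, max_lt_iff, Real.dist_eq, Real.dist_eq, sub_zero, sub_zero,
      abs_of_pos hσ.1, abs_of_pos hh.1]
    exact ⟨hσ.2.trans_lt hh.2, hh.2⟩
  rw [Real.dist_eq, h1, abs_mul, abs_of_pos (inv_pos.2 hh.1)]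
  rw [sub_zero, abs_of_pos hh.1, Real.norm_eq_abs] at h2
  calc h⁻¹ * |∫ σ in 0..h, (Φ (σ, h) - Φ (0, 0))| ≤ h⁻¹ * (ε / 2 * h) := by
        gcongr; exact (inv_pos.2 hh.1).le
    _ = ε / 2 := by have := hh.1.ne'; field_simp
    _ < ε := half_lt_self hε

variable {X Y : Type*} [NormedAddCommGroup X] [NormedSpace ℝ X] [NormedAddCommGroup Y]
  [InnerProductSpace ℝ Y]

/-- The pairing of square integrable functions with values in a space and in its dual. -/
theorem integrable_dual_apply {α : Type*} [MeasurableSpace α] {ν : Measure α}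
    {a : α → StrongDual ℝ X} {b : α → X} (ha : MemLp a 2 ν) (hb : MemLp b 2 ν) :
    Integrable (fun x => a x (b x)) ν := by
  have h := (ha.norm.integrable_mul hb.norm)
  refine h.mono (ContinuousLinearMap.aestronglyMeasurable_comp₂
    (ContinuousLinearMap.id ℝ (StrongDual ℝ X)) ha.1 hb.1) (Eventually.of_forall fun x => ?_)
  simp only [Pi.mul_apply, norm_mul, norm_norm]
  exact (a x).le_opNorm (b x)

/-- The shear `(r, σ) ↦ (r + σ, σ)` preserves measure, so both factors are square integrable on the
strip. This licenses the Fubini step in the energy identity. -/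
theorem integrable_translate_apply {a : ℝ → StrongDual ℝ X} {b : ℝ → X}
    (ha : MemLp a 2 volume) (hb : MemLp b 2 volume) (s t h : ℝ) :
    Integrable (Function.uncurry fun r σ => a (r + σ) (b r))
      ((volume.restrict (Ioc s t)).prod (volume.restrict (Ioc 0 h))) := by
  have hmp : MeasurePreserving (fun z : ℝ × ℝ => (z.1 + z.2, z.2))
      (volume.prod (volume.restrict (Ioc 0 h))) (volume.prod (volume.restrict (Ioc 0 h))) :=
    measurePreserving_add_prod volume _
  have h1 : MemLp (fun z : ℝ × ℝ => a (z.1 + z.2)) 2 (volume.prod (volume.restrict (Ioc 0 h))) :=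
    (ha.comp_fst (volume.restrict (Ioc 0 h))).comp_measurePreserving hmp
  have h2 : MemLp (fun z : ℝ × ℝ => b z.1) 2 (volume.prod (volume.restrict (Ioc 0 h))) :=
    hb.comp_fst (volume.restrict (Ioc 0 h))
  refine (integrable_dual_apply h1 h2).mono_measure ?_
  exact Measure.prod_mono Measure.restrict_le_self le_rfl

theorem integrable_norm_sq_comp (j : X →L[ℝ] Y) {α : Type*} [MeasurableSpace α] {ν : Measure α}
    {b : α → X} (hb : MemLp b 2 ν) : Integrable (fun x => ‖j (b x)‖ ^ 2) ν :=
  (j.comp_memLp' hb).integrable_norm_pow (by norm_num)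

/-- The energy identity between two Lebesgue points of `r ↦ ‖j (b r)‖ ^ 2`. -/
theorem norm_sq_sub_norm_sq_of_hasDerivAt (j : X →L[ℝ] Y) {T : ℝ} {a : ℝ → StrongDual ℝ X}
    {b : ℝ → X} (ha : MemLp a 2 volume) (hb : MemLp b 2 volume) {c : StrongDual ℝ X}
    (hrep : ∀ᵐ r, r ∈ Ioo 0 T → (innerSL ℝ (j (b r))).comp j = c + ∫ ρ in 0..r, a ρ)
    {s t : ℝ} (hs : 0 < s) (hst : s < t) (ht : t < T)
    (hds : HasDerivAt (fun x => ∫ r in 0..x, ‖j (b r)‖ ^ 2) (‖j (b s)‖ ^ 2) s)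
    (hdt : HasDerivAt (fun x => ∫ r in 0..x, ‖j (b r)‖ ^ 2) (‖j (b t)‖ ^ 2) t) :
    ‖j (b t)‖ ^ 2 - ‖j (b s)‖ ^ 2 = 2 * ∫ r in s..t, a r (b r) := by
  set g : ℝ → ℝ := fun r => ‖j (b r)‖ ^ 2 with hg
  have hgi : Integrable g volume := integrable_norm_sq_comp j hb
  have hai := intervalIntegrable_of_memLp_two ha
  obtain ⟨A, hAc, hA⟩ := exists_continuous_translate ha (Ioc s t)
  obtain ⟨B, hBc, hB⟩ := exists_continuous_translate hb (Ioc s t)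
  -- Writing the integral over `r` as an `L²` pairing of translates makes it jointly continuous in
  -- the two shifts.
  set Φ : ℝ × ℝ → ℝ := fun z => (ContinuousLinearMap.id ℝ (StrongDual ℝ X)).lpPairing
    (volume.restrict (Ioc s t)) 2 2 (A z.1) (B z.2 + B 0) with hΦ
  have hΦc : Continuous Φ := by fun_prop
  have hΦe : ∀ σ h, Φ (σ, h) = ∫ r in Ioc s t, a (r + σ) (b (r + h) + b r) := by
    intro σ h
    simp only [hΦ, ContinuousLinearMap.lpPairing_eq_integral]
    refine integral_congr_ae ?_
    filter_upwards [hA σ, hB h, hB 0, Lp.coeFn_add (B h) (B 0)] with r h1 h2 h3 h4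
    rw [h1, h4, Pi.add_apply, h2, h3, add_zero]
    rfl
  -- The condition `h < T - t` keeps `r + h` inside `(0, T)`. Pairing with the sum `b (r + h) + b r`
  -- makes the cross terms cancel by symmetry of the inner product, and integration over `r`
  -- telescopes to the two end intervals.
  have hkey : ∀ h ∈ Ioo 0 (T - t),
      (∫ r in t..t + h, g r) - (∫ r in s..s + h, g r) = ∫ σ in 0..h, Φ (σ, h) := by
    intro h hh
    have hbh : MemLp (fun r => b (r + h) + b r) 2 volume :=
      (hb.comp_measurePreserving (measurePreserving_add_right volume h)).add hb
    have hae : ∀ᵐ r, r ∈ Ioc s t →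
        ∫ σ in Ioc 0 h, a (r + σ) (b (r + h) + b r) = g (r + h) - g r := by
      filter_upwards [hrep, (measurePreserving_add_right volume h).quasiMeasurePreserving.ae hrep]
        with r h1 h2 hr
      have h1' := h1 ⟨hs.trans hr.1, hr.2.trans_lt ht⟩
      have h2' := h2 ⟨by linarith [hr.1, hh.1], by linarith [hr.2, hh.2]⟩
      have h3 : ∫ ρ in r..r + h, a ρ
          = (innerSL ℝ (j (b (r + h)))).comp j - (innerSL ℝ (j (b r))).comp j := by
        rw [h1', h2', add_sub_add_left_eq_sub,
          intervalIntegral.integral_interval_sub_left (hai _ _) (hai _ _)]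
      have h4 := congrArg (fun L : StrongDual ℝ X => L (b (r + h) + b r)) h3
      simp only [sub_apply, ContinuousLinearMap.comp_apply, innerSL_apply_apply,
        map_add] at h4
      rw [← ContinuousLinearMap.map_add, ContinuousLinearMap.intervalIntegral_apply (hai _ _)] at h4
      rw [← intervalIntegral.integral_of_le hh.1.le,
        intervalIntegral.integral_comp_add_left (fun ρ => a ρ (b (r + h) + b r)) r, add_zero, h4]
      simp only [hg, ← real_inner_self_eq_norm_sq]
      rw [real_inner_comm (j (b r)) (j (b (r + h)))]
      ring
    have hint : Integrable (Function.uncurry fun r σ => a (r + σ) (b (r + h) + b r))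
        ((volume.restrict (Ioc s t)).prod (volume.restrict (Ioc 0 h))) :=
      integrable_translate_apply ha hbh s t h
    have hsw := integral_integral_swap hint
    have hgh : Integrable (fun r => g (r + h)) volume := hgi.comp_add_right h
    rw [setIntegral_congr_ae measurableSet_Ioc hae, integral_sub hgh.integrableOn hgi.integrableOn,
      ← intervalIntegral.integral_of_le hst.le, ← intervalIntegral.integral_of_le hst.le,
      intervalIntegral.integral_comp_add_right g h] at hsw
    rw [intervalIntegral.integral_of_le hh.1.le]
    simp only [hΦe]
    rw [← hsw]
    have hI : ∀ x y, IntervalIntegrable g volume x y := fun x y => hgi.intervalIntegrable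
    have e1 := intervalIntegral.integral_add_adjacent_intervals (hI s t) (hI t (t + h))
    have e2 := intervalIntegral.integral_add_adjacent_intervals (hI s (s + h)) (hI (s + h) (t + h))
    linarith
  -- After division by `h` the end intervals converge because `s` and `t` are differentiation points
  -- of the primitive of `g`.
  have hlim1 := hdt.tendsto_slope_zero_right.sub hds.tendsto_slope_zero_right
  have hlim2 : Tendsto (fun h => h⁻¹ * ∫ σ in 0..h, Φ (σ, h)) (𝓝[>] 0) (𝓝 (g t - g s)) := by
    refine hlim1.congr' ?_
    filter_upwards [Ioo_mem_nhdsGT (sub_pos.2 ht)] with h hh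
    have hI : ∀ x y, IntervalIntegrable g volume x y := fun x y => hgi.intervalIntegrable
    rw [← hkey h hh, intervalIntegral.integral_interval_sub_left (hI _ _) (hI _ _),
      intervalIntegral.integral_interval_sub_left (hI _ _) (hI _ _), smul_eq_mul, smul_eq_mul,
      mul_sub]
  rw [tendsto_nhds_unique hlim2 (tendsto_inv_mul_integral_of_continuous hΦc), hΦe,
    intervalIntegral.integral_of_le hst.le, ← integral_const_mul]
  refine integral_congr_ae (Eventually.of_forall fun r => ?_)
  simp only [add_zero, map_add]
  ring

end

/-! ### Continuous representative in the pivot space -/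

section

/-- Near any point of `closure G` the increments of `P` are small, so `v` is Cauchy along `G` there;
completeness supplies the limits that define the extension. -/
theorem exists_continuousOn_extension {Y : Type*} [NormedAddCommGroup Y] [CompleteSpace Y]
    {G S : Set ℝ} (hGS : S ⊆ closure G) {v : ℝ → Y} {P : ℝ → ℝ} (hP : Continuous P) (K : ℝ)
    (hv : ∀ s ∈ G, ∀ t ∈ G, ‖v t - v s‖ ^ 2 ≤ K * |P t - P s|) :
    ContinuousOn (extendFrom G v) S ∧ (∀ t ∈ G, extendFrom G v t = v t) ∧
      ∀ t ∈ S, extendFrom G v t ∈ closure (v '' G) := by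
  have hlim : ∀ x ∈ closure G, ∃ y, Tendsto v (𝓝[G] x) (𝓝 y) := by
    intro x hx
    have : (𝓝[G] x).NeBot := mem_closure_iff_nhdsWithin_neBot.1 hx
    suffices hC : Cauchy (map v (𝓝[G] x)) from CompleteSpace.complete hC
    rw [Metric.cauchy_iff]
    refine ⟨inferInstance, fun ε hε => ?_⟩
    -- Half of `ε² / (|K| + 1)`, since two points are each compared with `x`; the `+ 1` covers `K =
    -- 0`.
    have hδ : 0 < ε ^ 2 / (2 * (|K| + 1)) := by positivity
    have hnear : ∀ᶠ y in 𝓝[G] x, |P y - P x| < ε ^ 2 / (2 * (|K| + 1)) :=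
      nhdsWithin_le_nhds (Metric.tendsto_nhds.1 (hP.tendsto x) _ hδ)
    refine ⟨v '' {y | y ∈ G ∧ |P y - P x| < ε ^ 2 / (2 * (|K| + 1))},
      image_mem_map (inter_mem self_mem_nhdsWithin hnear), ?_⟩
    rintro _ ⟨t, ht, rfl⟩ _ ⟨s, hs, rfl⟩
    rw [dist_eq_norm]
    refine lt_of_pow_lt_pow_left₀ 2 hε.le ((hv s hs.1 t ht.1).trans_lt ?_)
    have h1 : |P t - P s| < ε ^ 2 / (|K| + 1) := by
      have h2 := abs_sub_le (P t) (P x) (P s)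
      have h3 := ht.2
      have h4 := hs.2
      rw [abs_sub_comm (P s)] at h4
      have h5 : ε ^ 2 / (|K| + 1) = ε ^ 2 / (2 * (|K| + 1)) + ε ^ 2 / (2 * (|K| + 1)) := by
        field_simp; ring
      linarith
    calc K * |P t - P s| ≤ (|K| + 1) * |P t - P s| := by
          gcongr; linarith [le_abs_self K]
      _ < (|K| + 1) * (ε ^ 2 / (|K| + 1)) := by gcongr
      _ = ε ^ 2 := by field_simp
  refine ⟨continuousOn_extendFrom hGS fun x hx => hlim x (hGS hx), fun t ht => ?_, fun t ht => ?_⟩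
  · obtain ⟨y, hy⟩ := hlim t (subset_closure ht)
    rw [extendFrom_eq (subset_closure ht) hy]
    exact tendsto_nhds_unique (hy.mono_left (pure_le_nhdsWithin ht)) (tendsto_pure_nhds v t)
  · obtain ⟨y, hy⟩ := hlim t (hGS ht)
    rw [extendFrom_eq (hGS ht) hy]
    have : (𝓝[G] t).NeBot := mem_closure_iff_nhdsWithin_neBot.1 (hGS ht)
    exact mem_closure_of_tendsto hy (eventually_mem_nhdsWithin.mono fun x hx => mem_image_of_mem v hx)

variable {X Y : Type*} [NormedAddCommGroup X] [NormedSpace ℝ X] [NormedAddCommGroup Y]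
  [InnerProductSpace ℝ Y]

/-- The functional `z ↦ ⟪j v, j z⟫`. -/
noncomputable def pivotDual (j : X →L[ℝ] Y) (v : X) : StrongDual ℝ X := (innerSL ℝ (j v)).comp j

theorem pivotDual_apply (j : X →L[ℝ] Y) (v z : X) : pivotDual j v z = inner ℝ (j v) (j z) := rfl

theorem norm_pivotDual_le (j : X →L[ℝ] Y) (v : X) : ‖pivotDual j v‖ ≤ ‖j‖ * ‖j‖ * ‖v‖ := by
  refine (ContinuousLinearMap.opNorm_comp_le _ _).trans ?_
  rw [innerSL_apply_norm]
  calc ‖j v‖ * ‖j‖ ≤ ‖j‖ * ‖v‖ * ‖j‖ := by gcongr; exact j.le_opNorm v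
    _ = _ := by ring

theorem memLp_pivotDual (j : X →L[ℝ] Y) {α : Type*} [MeasurableSpace α] {ν : Measure α}
    {b : α → X} (hb : MemLp b 2 ν) : MemLp (fun x => pivotDual j (b x)) 2 ν := by
  have hc : Continuous (pivotDual j) := by unfold pivotDual; fun_prop
  exact hb.of_le_mul (hc.comp_aestronglyMeasurable hb.1)
    (Eventually.of_forall fun x => norm_pivotDual_le j (b x))

/-- If the energy identity holds on a set of times, then `j ∘ b` is controlled there by the
primitive of `‖a‖ ^ 2 + ‖b‖ ^ 2`. -/
theorem norm_sub_sq_le_of_energy (j : X →L[ℝ] Y) {a : ℝ → StrongDual ℝ X} {b : ℝ → X}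
    (ha : MemLp a 2 volume) (hb : MemLp b 2 volume) {c : StrongDual ℝ X} {G : Set ℝ} {T : ℝ}
    (hGT : G ⊆ Ioo 0 T) (hG : ∀ᵐ t, t ∈ Ioo 0 T → t ∈ G)
    (hrep : ∀ r ∈ G, pivotDual j (b r) = c + ∫ ρ in 0..r, a ρ)
    (hen : ∀ s ∈ G, ∀ t ∈ G, ‖j (b t)‖ ^ 2 - ‖j (b s)‖ ^ 2 = 2 * ∫ r in s..t, a r (b r)) :
    ∀ s ∈ G, ∀ t ∈ G, ‖j (b t) - j (b s)‖ ^ 2 ≤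
      8 * |(∫ r in 0..t, (‖a r‖ ^ 2 + ‖b r‖ ^ 2)) - ∫ r in 0..s, (‖a r‖ ^ 2 + ‖b r‖ ^ 2)| := by
  have ha2 : Integrable (fun r => ‖a r‖ ^ 2) volume := ha.integrable_norm_pow (by norm_num)
  have hb2 : Integrable (fun r => ‖b r‖ ^ 2) volume := hb.integrable_norm_pow (by norm_num)
  have hab2 : Integrable (fun r => ‖a r‖ ^ 2 + ‖b r‖ ^ 2) volume := ha2.add hb2
  have hai := intervalIntegrable_of_memLp_two ha
  have habi : Integrable (fun r => a r (b r)) volume := integrable_dual_apply ha hb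
  -- Expand `‖x - r‖² = ‖x‖² - ‖r‖² - 2 ⟪x - r, r⟫`: the energy identity gives the first difference,
  -- the representation paired with `b r` gives the last term.
  have hdiff : ∀ r ∈ G, ∀ x ∈ G,
      ‖j (b x) - j (b r)‖ ^ 2 = 2 * ∫ ρ in r..x, (a ρ (b ρ) - a ρ (b r)) := by
    intro r hr x hx
    have h3 : ∫ ρ in r..x, a ρ = pivotDual j (b x) - pivotDual j (b r) := by
      rw [hrep r hr, hrep x hx, add_sub_add_left_eq_sub,
        intervalIntegral.integral_interval_sub_left (hai _ _) (hai _ _)]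
    have h4 := congrArg (fun L : StrongDual ℝ X => L (b r)) h3
    simp only [sub_apply, pivotDual_apply] at h4
    rw [ContinuousLinearMap.intervalIntegral_apply (hai _ _)] at h4
    have h5 : IntervalIntegrable (fun ρ => a ρ (b r)) volume r x :=
      ⟨(ContinuousLinearMap.apply ℝ ℝ (b r)).integrable_comp (hai r x).1,
        (ContinuousLinearMap.apply ℝ ℝ (b r)).integrable_comp (hai r x).2⟩
    rw [intervalIntegral.integral_sub habi.intervalIntegrable h5, mul_sub, ← hen r hr x hx, h4,
      norm_sub_sq_real, real_inner_self_eq_norm_sq]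
    ring
  have hlt : ∀ s ∈ G, ∀ t ∈ G, s < t → ‖j (b t) - j (b s)‖ ^ 2 ≤
      8 * ∫ r in s..t, (‖a r‖ ^ 2 + ‖b r‖ ^ 2) := by
    intro s hs t ht hst
    set J := ∫ r in s..t, (‖a r‖ ^ 2 + ‖b r‖ ^ 2) with hJ
    -- The norm `‖b s‖` in `X` is not controlled by the integral, so the comparison goes through an
    -- intermediate time at which `‖b r‖²` is at most its mean.
    obtain ⟨r, hrG, hrs, hr⟩ : ∃ r ∈ G, r ∈ Ioo s t ∧
        (t - s) * ‖b r‖ ^ 2 ≤ ∫ ρ in Ioc s t, ‖b ρ‖ ^ 2 := by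
      have hN : (volume.restrict (Ioo s t)) Gᶜ = 0 := by
        have : ∀ᵐ x ∂(volume.restrict (Ioo s t)), x ∈ G := by
          rw [ae_restrict_iff' measurableSet_Ioo]
          filter_upwards [hG] with x hx hx'
          exact hx ⟨(hGT hs).1.trans hx'.1, hx'.2.trans (hGT ht).2⟩
        exact ae_iff.1 this
      have hne : volume (Ioo s t) ≠ 0 := by simp [hst]
      have hN' : (volume.restrict (Ioo s t)) (Gᶜ ∪ (Ioo s t)ᶜ) = 0 := by
        refine measure_union_null hN ?_
        rw [Measure.restrict_apply measurableSet_Ioo.compl, compl_inter_self, measure_empty]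
      obtain ⟨r, hr, hle⟩ := exists_notMem_null_le_average (μ := volume.restrict (Ioo s t))
        (by rwa [Ne, Measure.restrict_eq_zero]) hb2.integrableOn hN'
      rw [mem_union, not_or, notMem_compl_iff, notMem_compl_iff] at hr
      refine ⟨r, hr.1, hr.2, ?_⟩
      rw [average_eq, smul_eq_mul, measureReal_restrict_apply_univ, Real.volume_real_Ioo_of_le hst.le,
        ← integral_Ioc_eq_integral_Ioo] at hle
      have h0 : 0 < t - s := sub_pos.2 hst
      calc (t - s) * ‖b r‖ ^ 2 ≤ (t - s) * ((t - s)⁻¹ * ∫ ρ in Ioc s t, ‖b ρ‖ ^ 2) := by gcongr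
        _ = _ := by field_simp
    have hhalf : ∀ x ∈ G, uIoc r x ⊆ Ioc s t → ‖j (b x) - j (b r)‖ ^ 2 ≤ 2 * J := by
      intro x hx hsub
      have hconst : IntegrableOn (fun _ => ‖b r‖ ^ 2 / 2) (Ioc s t) volume :=
        integrableOn_const (by simp)
      have hbr : IntegrableOn (fun ρ => ‖b ρ‖ ^ 2 / 2 + ‖b r‖ ^ 2 / 2) (Ioc s t) volume :=
        (hb2.div_const 2).integrableOn.add hconst
      have hdom : IntegrableOn (fun ρ => ‖a ρ‖ ^ 2 + (‖b ρ‖ ^ 2 / 2 + ‖b r‖ ^ 2 / 2)) (Ioc s t)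
          volume := ha2.integrableOn.add hbr
      rw [hdiff r hrG x hx]
      have h1 : |∫ ρ in r..x, (a ρ (b ρ) - a ρ (b r))|
          ≤ ∫ ρ in Ioc s t, (‖a ρ‖ ^ 2 + (‖b ρ‖ ^ 2 / 2 + ‖b r‖ ^ 2 / 2)) := by
        rw [← Real.norm_eq_abs]
        refine intervalIntegral.norm_integral_le_integral_norm_uIoc.trans ?_
        refine (integral_mono_of_nonneg (Eventually.of_forall fun _ => norm_nonneg _)
          (hdom.mono_set hsub) (Eventually.of_forall fun ρ => ?_)).trans
          (setIntegral_mono_set hdom (Eventually.of_forall fun _ => by positivity) hsub.eventuallyLE)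
        have e1 := (a ρ).le_opNorm (b ρ)
        have e2 := (a ρ).le_opNorm (b r)
        have e3 := norm_sub_le (a ρ (b ρ)) (a ρ (b r))
        change ‖a ρ (b ρ) - a ρ (b r)‖ ≤ ‖a ρ‖ ^ 2 + (‖b ρ‖ ^ 2 / 2 + ‖b r‖ ^ 2 / 2)
        have e4 := two_mul_le_add_sq ‖a ρ‖ ‖b ρ‖
        have e5 := two_mul_le_add_sq ‖a ρ‖ ‖b r‖
        linarith
      have h2 : ∫ ρ in Ioc s t, (‖a ρ‖ ^ 2 + (‖b ρ‖ ^ 2 / 2 + ‖b r‖ ^ 2 / 2)) ≤ J := by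
        have i1 : ∫ ρ in Ioc s t, (‖a ρ‖ ^ 2 + (‖b ρ‖ ^ 2 / 2 + ‖b r‖ ^ 2 / 2))
            = (∫ ρ in Ioc s t, ‖a ρ‖ ^ 2) + ((∫ ρ in Ioc s t, ‖b ρ‖ ^ 2) / 2
              + (t - s) * ‖b r‖ ^ 2 / 2) := by
          rw [integral_add ha2.integrableOn hbr,
            integral_add (hb2.div_const 2).integrableOn hconst, integral_div, setIntegral_const,
            Real.volume_real_Ioc_of_le hst.le, smul_eq_mul]
          ring
        have i2 : J = (∫ ρ in Ioc s t, ‖a ρ‖ ^ 2) + ∫ ρ in Ioc s t, ‖b ρ‖ ^ 2 := by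
          rw [hJ, intervalIntegral.integral_of_le hst.le,
            integral_add ha2.integrableOn hb2.integrableOn]
        rw [i1, i2]
        linarith
      linarith [le_abs_self (∫ ρ in r..x, (a ρ (b ρ) - a ρ (b r)))]
    have h1 := hhalf t ht (by rw [uIoc_of_le hrs.2.le]; exact Ioc_subset_Ioc_left hrs.1.le)
    have h2 := hhalf s hs (by rw [uIoc_of_ge hrs.1.le]; exact Ioc_subset_Ioc_right hrs.2.le)
    have h3 : ‖j (b t) - j (b s)‖ ≤ ‖j (b t) - j (b r)‖ + ‖j (b s) - j (b r)‖ := by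
      rw [← norm_neg (j (b s) - j (b r)), neg_sub]
      exact norm_sub_le_norm_sub_add_norm_sub _ _ _
    -- Each half contributes at most `2 J`, whence `2 (2 J + 2 J) = 8 J`.
    calc ‖j (b t) - j (b s)‖ ^ 2 ≤ (‖j (b t) - j (b r)‖ + ‖j (b s) - j (b r)‖) ^ 2 := by gcongr
      _ ≤ 2 * (‖j (b t) - j (b r)‖ ^ 2 + ‖j (b s) - j (b r)‖ ^ 2) := add_sq_le
      _ ≤ 8 * J := by linarith
  intro s hs t ht
  rw [intervalIntegral.integral_interval_sub_left hab2.intervalIntegrable hab2.intervalIntegrable]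
  rcases lt_trichotomy s t with h | rfl | h
  · exact (hlt s hs t ht h).trans (by gcongr; exact le_abs_self _)
  · simp
  · rw [norm_sub_rev, intervalIntegral.integral_symm, abs_neg]
    exact (hlt t ht s hs h).trans (by gcongr; exact le_abs_self _)

/-- Extension by zero, so that time translates make sense on the whole line. -/
theorem exists_memLp_extension {E : Type*} [NormedAddCommGroup E] {S : Set ℝ}
    (hS : MeasurableSet S) {w : ℝ → E} (hw : MemLp w 2 (volume.restrict S)) :
    ∃ a : ℝ → E, MemLp a 2 volume ∧ ∀ t ∈ S, a t = w t :=
  ⟨S.indicator w, (memLp_indicator_iff_restrict hS).2 hw, fun _ ht => indicator_of_mem ht w⟩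

/-- The Lions–Magenes theorem: a function in `L²(0, T; X)` whose derivative lies in `L²(0, T; X')`
has a continuous representative in the pivot space and satisfies the energy identity. -/
theorem exists_continuous_representative [CompleteSpace Y] (j : X →L[ℝ] Y) {T : ℝ} (hT : 0 < T)
    {u : ℝ → X} {w : ℝ → StrongDual ℝ X} (hu : MemLp u 2 (volume.restrict (Ioo 0 T)))
    (hw : MemLp w 2 (volume.restrict (Ioo 0 T)))
    (hder : ∀ η : ℝ → ℝ, ContDiff ℝ ∞ η → HasCompactSupport η → tsupport η ⊆ Ioo 0 T →
      ∫ t in 0..T, deriv η t • pivotDual j (u t) = -∫ t in 0..T, η t • w t) :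
    ∃ U : ℝ → Y, ContinuousOn U (Icc 0 T) ∧
      (∀ᵐ t ∂(volume.restrict (Ioo 0 T)), U t = j (u t)) ∧
      (∀ t ∈ Icc 0 T, U t ∈ closure (range j)) ∧
      ∀ s ∈ Icc 0 T, ∀ t ∈ Icc 0 T,
        ‖U t‖ ^ 2 - ‖U s‖ ^ 2 = 2 * ∫ r in s..t, w r (u r) := by
  obtain ⟨a, ha, hau⟩ : ∃ a : ℝ → StrongDual ℝ X, MemLp a 2 volume ∧ ∀ t ∈ Ioo 0 T, a t = w t :=
    exists_memLp_extension measurableSet_Ioo hw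
  obtain ⟨b, hb, hbu⟩ : ∃ b : ℝ → X, MemLp b 2 volume ∧ ∀ t ∈ Ioo 0 T, b t = u t :=
    exists_memLp_extension measurableSet_Ioo hu
  have hne : ∀ᵐ t : ℝ, t ≠ T := by simp [ae_iff]
  obtain ⟨c, hc⟩ : ∃ c, ∀ᵐ t, t ∈ Ioo 0 T → pivotDual j (b t) = c + ∫ s in 0..t, a s := by
    refine exists_ae_eq_const_add_integral hT
      (intervalIntegrable_of_memLp_two (memLp_pivotDual j hb) _ _)
      (intervalIntegrable_of_memLp_two ha _ _) fun η h1 h2 h3 => ?_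
    rw [← sub_eq_zero, ← sub_eq_zero.2 (hder η h1 h2 h3)]
    congr 1
    · refine intervalIntegral.integral_congr_ae ?_
      filter_upwards [hne] with t ht ht'
      rw [uIoc_of_le hT.le] at ht'
      rw [hbu t ⟨ht'.1, ht'.2.lt_of_ne ht⟩]
    · congr 1
      refine intervalIntegral.integral_congr_ae ?_
      filter_upwards [hne] with t ht ht'
      rw [uIoc_of_le hT.le] at ht'
      rw [hau t ⟨ht'.1, ht'.2.lt_of_ne ht⟩]
  -- The good times: the representation holds and `t` is a differentiation point. They have full
  -- measure in `(0, T)` and are therefore dense in `[0, T]`.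
  set G : Set ℝ := {t | t ∈ Ioo 0 T ∧ pivotDual j (b t) = c + (∫ s in 0..t, a s) ∧
    HasDerivAt (fun x => ∫ r in 0..x, ‖j (b r)‖ ^ 2) (‖j (b t)‖ ^ 2) t} with hG_def
  have hGT : G ⊆ Ioo 0 T := fun t ht => ht.1
  have hG : ∀ᵐ t, t ∈ Ioo 0 T → t ∈ G := by
    filter_upwards [hc,
      _root_.LocallyIntegrable.ae_hasDerivAt_integral
        (integrable_norm_sq_comp j hb).locallyIntegrable] with t h1 h2 ht
    exact ⟨ht, h1 ht, h2 0⟩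
  have hen : ∀ s ∈ G, ∀ t ∈ G, ‖j (b t)‖ ^ 2 - ‖j (b s)‖ ^ 2 = 2 * ∫ r in s..t, a r (b r) := by
    have hlt : ∀ s ∈ G, ∀ t ∈ G, s < t →
        ‖j (b t)‖ ^ 2 - ‖j (b s)‖ ^ 2 = 2 * ∫ r in s..t, a r (b r) := fun s hs t ht hst =>
      norm_sq_sub_norm_sq_of_hasDerivAt j ha hb hc hs.1.1 hst ht.1.2 hs.2.2 ht.2.2
    intro s hs t ht
    rcases lt_trichotomy s t with h | rfl | h
    · exact hlt s hs t ht h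
    · simp
    · rw [intervalIntegral.integral_symm, mul_neg, ← hlt t ht s hs h, neg_sub]
  have hmod := norm_sub_sq_le_of_energy j ha hb hGT hG (fun r hr => hr.2.1) hen
  have hcl : Icc 0 T ⊆ closure G := by
    rw [← closure_Ioo hT.ne]
    refine closure_minimal ?_ isClosed_closure
    refine ((Measure.dense_of_ae hG).open_subset_closure_inter isOpen_Ioo).trans
      (closure_mono fun t ht => ht.2 ht.1)
  have hP : Continuous fun t => ∫ r in 0..t, (‖a r‖ ^ 2 + ‖b r‖ ^ 2) :=
    intervalIntegral.continuous_primitive (fun x y => ((ha.integrable_norm_pow (by norm_num)).add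
      (hb.integrable_norm_pow (by norm_num))).intervalIntegrable) 0
  obtain ⟨hUc, hUG, hUcl⟩ := exists_continuousOn_extension (v := fun t => j (b t)) hcl hP 8 hmod
  have habi : ∀ x y, IntervalIntegrable (fun r => a r (b r)) volume x y := fun x y =>
    (integrable_dual_apply ha hb).intervalIntegrable
  refine ⟨extendFrom G fun t => j (b t), hUc, ?_, fun t ht => ?_, ?_⟩
  · rw [ae_restrict_iff' measurableSet_Ioo]
    filter_upwards [hG] with t ht ht'
    rw [hUG t (ht ht'), hbu t ht']
  · refine closure_mono ?_ (hUcl t ht)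
    rintro _ ⟨x, -, rfl⟩
    exact mem_range_self _
  · intro s hs t ht
    set U := extendFrom G fun t => j (b t)
    have hF : ContinuousOn (fun x => ‖U x‖ ^ 2 - 2 * ∫ r in 0..x, a r (b r)) (Icc 0 T) :=
      (hUc.norm.pow 2).sub
        (continuous_const.mul (intervalIntegral.continuous_primitive habi 0)).continuousOn
    obtain ⟨r₀, hr₀⟩ : G.Nonempty :=
      closure_nonempty_iff.1 ⟨s, hcl hs⟩
    -- Both sides are continuous and agree on the dense set `G`, so the energy identity reaches
    -- every time, including `0` and `T`.
    have hconst : EqOn (fun x => ‖U x‖ ^ 2 - 2 * ∫ r in 0..x, a r (b r))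
        (fun _ => ‖U r₀‖ ^ 2 - 2 * ∫ r in 0..r₀, a r (b r)) (Icc 0 T) := by
      refine EqOn.of_subset_closure (fun x hx => ?_) hF continuousOn_const
        (hGT.trans Ioo_subset_Icc_self) hcl
      have h1 := hen r₀ hr₀ x hx
      rw [← intervalIntegral.integral_interval_sub_left (habi 0 x) (habi 0 r₀)] at h1
      change ‖U x‖ ^ 2 - _ = ‖U r₀‖ ^ 2 - _
      rw [hUG x hx, hUG r₀ hr₀]
      linarith
    have h1 := (hconst ht).trans (hconst hs).symm
    have h2 : ∫ r in s..t, w r (u r) = ∫ r in s..t, a r (b r) := by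
      refine intervalIntegral.integral_congr_ae ?_
      filter_upwards [hne] with r hr hr'
      have hr1 := uIoc_subset_uIcc hr'
      have hr2 : r ∈ Ioo 0 T := by
        refine ⟨?_, ((uIcc_subset_Icc hs ht) hr1).2.lt_of_ne hr⟩
        rcases mem_uIoc.1 hr' with h | h
        · exact hs.1.trans_lt h.1
        · exact ht.1.trans_lt h.1
      rw [hau r hr2, hbu r hr2]
    rw [h2, ← intervalIntegral.integral_interval_sub_left (habi 0 t) (habi 0 s)]
    change ‖U t‖ ^ 2 - _ = ‖U s‖ ^ 2 - _ at h1
    linarith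

end

/-! ### Green's formula and the inclusion of `V` in `H` -/

theorem inner_tensor (A B : Tensor) : inner ℝ A B = ∑ i, ∑ j, A (i, j) * B (i, j) := by
  rw [PiLp.inner_apply, Fintype.sum_prod_type]
  simp [mul_comm]

theorem inner_plane (a b : Plane) : inner ℝ a b = ∑ i, a i * b i := by
  rw [PiLp.inner_apply]
  simp [mul_comm]

theorem jacobian_apply (φ : Plane → Plane) (x : Plane) (i j : Fin 2) :
    jacobian φ x (i, j) = fderiv ℝ φ x (EuclideanSpace.single j 1) i := rfl

theorem map_eq_sum_single {F : Type*} [AddCommGroup F] [Module ℝ F] [TopologicalSpace F]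
    (L : Plane →L[ℝ] F) (v : Plane) : L v = ∑ j, v j • L (EuclideanSpace.single j 1) := by
  conv_lhs => rw [← (EuclideanSpace.basisFun (Fin 2) ℝ).sum_repr v]
  simp

theorem fderiv_apply_eq_sum_jacobian (φ : Plane → Plane) (x v : Plane) (i : Fin 2) :
    fderiv ℝ φ x v i = ∑ j, v j * jacobian φ x (i, j) := by
  rw [map_eq_sum_single]
  simp [jacobian_apply]

theorem inner_gradient_eq (q : Plane → ℝ) (x v : Plane) :
    inner ℝ (gradient q x) v = fderiv ℝ q x v :=
  InnerProductSpace.toDual_symm_apply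

/-- Partial derivatives of compactly supported functions have zero integral. -/
theorem integral_fderiv_apply_eq_zero {χ : Plane → ℝ} (hχ : ContDiff ℝ 1 χ)
    (hc : HasCompactSupport χ) (v : Plane) : ∫ x, fderiv ℝ χ x v = 0 := by
  have hcont : Continuous fun x => fderiv ℝ χ x v :=
    (hχ.continuous_fderiv one_ne_zero).clm_apply continuous_const
  have hcs : HasCompactSupport fun x => fderiv ℝ χ x v := hc.fderiv_apply (𝕜 := ℝ) v
  have h := integral_mul_fderiv_eq_neg_fderiv_mul_of_integrable (μ := (volume : Measure Plane))
    (f := fun _ : Plane => (1 : ℝ)) (g := χ) (v := v) (by simp)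
    (by simpa using hcont.integrable_of_hasCompactSupport hcs)
    (by simpa using hχ.continuous.integrable_of_hasCompactSupport hc)
    (fun _ _ => differentiableAt_const _) (fun x _ => hχ.differentiable one_ne_zero x)
  simpa using h

/-- Near a point outside the support of `χ` the product is identically zero, so the behaviour of `q`
at the boundary of `Ω` is irrelevant. -/
theorem contDiff_mul_of_tsupport_subset {Ω : Set Plane} (hΩ : IsOpen Ω) {q χ : Plane → ℝ}
    (hq : ContDiffOn ℝ ∞ q Ω) (hχ : ContDiff ℝ ∞ χ) (hs : tsupport χ ⊆ Ω) :
    ContDiff ℝ ∞ fun x => q x * χ x := by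
  rw [contDiff_iff_contDiffAt]
  intro x
  by_cases hx : x ∈ tsupport χ
  · exact (hq.contDiffAt (hΩ.mem_nhds (hs hx))).mul hχ.contDiffAt
  · refine contDiffAt_const (c := (0 : ℝ)).congr_of_eventuallyEq ?_
    filter_upwards [notMem_tsupport_iff_eventuallyEq.1 hx] with y hy
    rw [hy]; simp

/-- The identity matrix. -/
noncomputable def oneTensor : Tensor := WithLp.toLp 2 fun ij => if ij.1 = ij.2 then 1 else 0

theorem inner_smul_oneTensor (A : Tensor) (c : ℝ) :
    inner ℝ (c • oneTensor) A = c * ∑ i, A (i, i) := by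
  rw [real_inner_smul_left, inner_tensor]
  simp [oneTensor]

theorem contDiff_coord {φ : Plane → Plane} (hφ : ContDiff ℝ ∞ φ) (i : Fin 2) :
    ContDiff ℝ ∞ fun x => φ x i :=
  (EuclideanSpace.proj (𝕜 := ℝ) i).contDiff.comp hφ

theorem fderiv_coord {φ : Plane → Plane} {x : Plane} (hφ : DifferentiableAt ℝ φ x) (i : Fin 2)
    (v : Plane) : fderiv ℝ (fun x => φ x i) x v = fderiv ℝ φ x v i := by
  have h : HasFDerivAt (fun x => φ x i)
      ((EuclideanSpace.proj (𝕜 := ℝ) i).comp (fderiv ℝ φ x)) x :=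
    (EuclideanSpace.proj (𝕜 := ℝ) i).hasFDerivAt.comp x hφ.hasFDerivAt
  rw [h.fderiv]; rfl

theorem tsupport_coord_subset (φ : Plane → Plane) (i : Fin 2) :
    tsupport (fun x => φ x i) ⊆ tsupport φ :=
  closure_mono fun x hx h0 => hx (by simp only; rw [h0]; rfl)

/-- Green's formula for a test field. -/
theorem setIntegral_inner_gradient_add_div {Ω : Set Plane} (hΩ : IsOpen Ω) {q : Plane → ℝ}
    (hq : ContDiffOn ℝ ∞ q Ω) {φ : Plane → Plane} (hφ : ContDiff ℝ ∞ φ) (hc : HasCompactSupport φ)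
    (hs : tsupport φ ⊆ Ω) :
    ∫ x in Ω, (inner ℝ (gradient q x) (φ x) + inner ℝ (q x • oneTensor) (jacobian φ x)) = 0 := by
  have hχ : ∀ i : Fin 2, ContDiff ℝ ∞ fun x => q x * φ x i := fun i =>
    contDiff_mul_of_tsupport_subset hΩ hq (contDiff_coord hφ i) ((tsupport_coord_subset φ i).trans hs)
  have hχs : ∀ i : Fin 2, tsupport (fun x => q x * φ x i) ⊆ tsupport φ := fun i =>
    (tsupport_mul_subset_right).trans (tsupport_coord_subset φ i)
  have hχc : ∀ i : Fin 2, HasCompactSupport fun x => q x * φ x i := fun i =>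
    hc.of_isClosed_subset (isClosed_tsupport _) (hχs i)
  have hpt : ∀ x ∈ Ω, inner ℝ (gradient q x) (φ x) + inner ℝ (q x • oneTensor) (jacobian φ x)
      = ∑ i, fderiv ℝ (fun x => q x * φ x i) x (EuclideanSpace.single i 1) := by
    intro x hx
    have hqx : DifferentiableAt ℝ q x :=
      (hq.contDiffAt (hΩ.mem_nhds hx)).differentiableAt (by simp)
    have hφx : DifferentiableAt ℝ φ x := hφ.differentiable (by simp) x
    have hφi : ∀ i : Fin 2, DifferentiableAt ℝ (fun x => φ x i) x := fun i =>
      (contDiff_coord hφ i).differentiable (by simp) x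
    rw [inner_gradient_eq, map_eq_sum_single, inner_smul_oneTensor, Finset.mul_sum,
      ← Finset.sum_add_distrib]
    refine Finset.sum_congr rfl fun i _ => ?_
    rw [fderiv_fun_mul hqx (hφi i)]
    simp only [add_apply, smul_apply, smul_eq_mul, fderiv_coord hφx, jacobian_apply]
    ring
  have hoff : ∀ x, x ∉ Ω →
      ∑ i, fderiv ℝ (fun x => q x * φ x i) x (EuclideanSpace.single i 1) = 0 := by
    refine fun x hx => Finset.sum_eq_zero fun i _ => ?_
    have : x ∉ tsupport (fderiv ℝ fun x => q x * φ x i) := fun h =>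
      hx (hs (hχs i (tsupport_fderiv_subset ℝ h)))
    rw [image_eq_zero_of_notMem_tsupport this]; rfl
  rw [setIntegral_congr_fun hΩ.measurableSet hpt, setIntegral_eq_integral_of_forall_compl_eq_zero
    hoff, integral_finsetSum]
  · exact Finset.sum_eq_zero fun i _ =>
      integral_fderiv_apply_eq_zero ((hχ i).of_le (by simp)) (hχc i) _
  · exact fun i _ => (((hχ i).continuous_fderiv (by simp)).clm_apply
      continuous_const).integrable_of_hasCompactSupport ((hχc i).fderiv_apply (𝕜 := ℝ) _)

/-- The left side is a continuous functional of `p` that vanishes on test pairs by Green's formula;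
its kernel is closed. No regularity of the boundary is needed. -/
theorem inner_gradient_add_trace_eq_zero {Ω : Set Plane} (hΩ : IsOpen Ω) {q : Plane → ℝ}
    (hq : ContDiffOn ℝ ∞ q Ω) {g : L2Vec Ω} (hg : g =ᵐ[volume.restrict Ω] gradient q) {Q : L2Ten Ω}
    (hQ : Q =ᵐ[volume.restrict Ω] fun x => q x • oneTensor) {p : L2Pair Ω} (hp : p ∈ H10 Ω) :
    inner ℝ g p.fst + inner ℝ Q p.snd = 0 := by
  let L : L2Pair Ω →L[ℝ] ℝ := (innerSL ℝ g).comp (WithLp.fstL 2 ℝ (L2Vec Ω) (L2Ten Ω)) +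
    (innerSL ℝ Q).comp (WithLp.sndL 2 ℝ (L2Vec Ω) (L2Ten Ω))
  have hle : H10 Ω ≤ LinearMap.ker (L : L2Pair Ω →ₗ[ℝ] ℝ) := by
    refine Submodule.topologicalClosure_minimal _ (Submodule.span_le.2 ?_) L.isClosed_ker
    rintro p ⟨φ, h1, h2, h3, h4, h5⟩
    change inner ℝ g p.fst + inner ℝ Q p.snd = 0
    rw [L2.inner_def, L2.inner_def, ← integral_add (L2.integrable_inner g p.fst)
      (L2.integrable_inner Q p.snd), ← setIntegral_inner_gradient_add_div hΩ hq h1 h2 h3]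
    refine integral_congr_ae ?_
    filter_upwards [hg, hQ, h4, h5] with x e1 e2 e3 e4
    rw [e1, e2, e3, e4]
  exact hle hp

/-- Elements of `V` are orthogonal to gradients. -/
theorem inner_field_eq_zero {Ω : Set Plane} (hΩ : IsOpen Ω) {g : L2Vec Ω} (hg : g ∈ gradients Ω)
    (v : V Ω) : inner ℝ g (field v) = 0 := by
  obtain ⟨q, hq, hqL, hgq⟩ := hg
  have hQm : MemLp (fun x => q x • oneTensor) 2 (volume.restrict Ω) :=
    ((ContinuousLinearMap.id ℝ ℝ).smulRight oneTensor).comp_memLp' hqL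
  have h := inner_gradient_add_trace_eq_zero hΩ hq hgq hQm.coeFn_toLp v.2.1
  have h0 : inner ℝ hQm.toLp (v : L2Pair Ω).snd = 0 := by
    rw [L2.inner_def]
    refine integral_eq_zero_of_ae ?_
    filter_upwards [hQm.coeFn_toLp, v.2.2] with x e1 e2
    rw [e1, inner_smul_oneTensor, e2, mul_zero]; rfl
  rw [h0, add_zero] at h
  exact h

theorem field_mem_H {Ω : Set Plane} (hΩ : IsOpen Ω) (v : V Ω) : field v ∈ H Ω := by
  refine (Submodule.mem_orthogonal _ _).2 fun g hg => ?_
  induction hg using Submodule.span_induction with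
  | mem x hx => exact inner_field_eq_zero hΩ hx v
  | zero => exact inner_zero_left _
  | add x y _ _ hx hy => rw [inner_add_left, hx, hy, add_zero]
  | smul c x _ hx => rw [real_inner_smul_left, hx, mul_zero]

/-! ### Approximation by test fields and the `L⁴` embedding -/

theorem jacobian_add {φ ψ : Plane → Plane} {x : Plane} (hφ : DifferentiableAt ℝ φ x)
    (hψ : DifferentiableAt ℝ ψ x) :
    jacobian (fun x => φ x + ψ x) x = jacobian φ x + jacobian ψ x := by
  ext ij
  simp [jacobian, fderiv_fun_add hφ hψ]

theorem jacobian_const_smul {φ : Plane → Plane} {x : Plane} (hφ : DifferentiableAt ℝ φ x) (c : ℝ) :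
    jacobian (fun x => c • φ x) x = c • jacobian φ x := by
  ext ij
  simp [jacobian, fderiv_fun_const_smul hφ]

theorem jacobian_zero (x : Plane) : jacobian (fun _ => 0) x = 0 := by
  ext ij
  simp [jacobian]

/-- Test pairs already form a subspace, so elements of `H10` are limits of single test pairs rather
than of combinations. -/
theorem span_testPairs_subset (Ω : Set Plane) :
    (Submodule.span ℝ (testPairs Ω) : Set (L2Pair Ω)) ⊆ testPairs Ω := by
  intro p hp
  induction hp using Submodule.span_induction with
  | mem x hx => exact hx
  | zero =>
    have hts : tsupport (fun _ : Plane => (0 : Plane)) = ∅ := tsupport_eq_empty_iff.2 rfl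
    refine ⟨fun _ => 0, contDiff_const, HasCompactSupport.zero, by simp [hts], ?_, ?_⟩
    · exact Lp.coeFn_zero Plane 2 (volume.restrict Ω)
    · filter_upwards [Lp.coeFn_zero Tensor 2 (volume.restrict Ω)] with x hx
      rw [jacobian_zero]
      exact hx
  | add p q _ _ hp hq =>
    obtain ⟨φ, a1, a2, a3, a4, a5⟩ := hp
    obtain ⟨ψ, b1, b2, b3, b4, b5⟩ := hq
    refine ⟨fun x => φ x + ψ x, a1.add b1, a2.add b2,
      (tsupport_add φ ψ).trans (union_subset a3 b3), ?_, ?_⟩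
    · filter_upwards [a4, b4, Lp.coeFn_add p.fst q.fst] with x h1 h2 h3
      rw [← h1, ← h2]
      exact h3
    · filter_upwards [a5, b5, Lp.coeFn_add p.snd q.snd] with x h1 h2 h3
      rw [jacobian_add (a1.differentiable (by simp) x) (b1.differentiable (by simp) x), ← h1, ← h2]
      exact h3
  | smul c p _ hp =>
    obtain ⟨φ, a1, a2, a3, a4, a5⟩ := hp
    have hsub : tsupport (fun x => c • φ x) ⊆ tsupport φ :=
      tsupport_smul_subset_right (fun _ => c) φ
    refine ⟨fun x => c • φ x, a1.const_smul c, a2.of_isClosed_subset (isClosed_tsupport _) hsub,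
      hsub.trans a3, ?_, ?_⟩
    · filter_upwards [a4, Lp.coeFn_smul c p.fst] with x h1 h3
      rw [← h1]
      exact h3
    · filter_upwards [a5, Lp.coeFn_smul c p.snd] with x h1 h3
      rw [jacobian_const_smul (a1.differentiable (by simp) x), ← h1]
      exact h3

theorem exists_seq_testPairs_tendsto {Ω : Set Plane} {p : L2Pair Ω} (hp : p ∈ H10 Ω) :
    ∃ P : ℕ → L2Pair Ω, (∀ n, P n ∈ testPairs Ω) ∧ Tendsto P atTop (𝓝 p) := by
  obtain ⟨P, h1, h2⟩ := mem_closure_iff_seq_limit.1 hp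
  exact ⟨P, fun n => span_testPairs_subset Ω (h1 n), h2⟩

theorem norm_fderiv_le_jacobian (φ : Plane → Plane) (x : Plane) :
    ‖fderiv ℝ φ x‖ ≤ 2 * ‖jacobian φ x‖ := by
  refine ContinuousLinearMap.opNorm_le_bound _ (by positivity) fun v => ?_
  have hcol : ∀ j : Fin 2, ‖fderiv ℝ φ x (EuclideanSpace.single j 1)‖ ≤ ‖jacobian φ x‖ := by
    intro j
    refine le_of_sq_le_sq ?_ (norm_nonneg _)
    rw [EuclideanSpace.norm_sq_eq, EuclideanSpace.norm_sq_eq, Fintype.sum_prod_type]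
    refine Finset.sum_le_sum fun i _ => ?_
    exact Finset.single_le_sum (f := fun j => ‖jacobian φ x (i, j)‖ ^ 2)
      (fun _ _ => by positivity) (Finset.mem_univ j)
  rw [map_eq_sum_single]
  calc ‖∑ j, v j • fderiv ℝ φ x (EuclideanSpace.single j 1)‖
      ≤ ∑ j, ‖v j • fderiv ℝ φ x (EuclideanSpace.single j 1)‖ := norm_sum_le _ _
    _ ≤ ∑ _j : Fin 2, ‖v‖ * ‖jacobian φ x‖ := by
        refine Finset.sum_le_sum fun j _ => ?_
        rw [norm_smul]
        exact mul_le_mul (PiLp.norm_apply_le v j) (hcol j) (norm_nonneg _) (norm_nonneg _)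
    _ = 2 * ‖jacobian φ x‖ * ‖v‖ := by
        rw [Finset.sum_const, Finset.card_univ, Fintype.card_fin, nsmul_eq_mul]; push_cast; ring

/-- Ladyzhenskaya's inequality for test fields. -/
theorem exists_eLpNorm_four_sq_le : ∃ K : NNReal, ∀ φ : Plane → Plane, ContDiff ℝ ∞ φ →
    HasCompactSupport φ →
    eLpNorm φ 4 volume ^ 2 ≤ K * (eLpNorm φ 2 volume * eLpNorm (jacobian φ) 2 volume) := by
  refine ⟨eLpNormLESNormFDerivOneConst (volume : Measure Plane) ((2 : NNReal) : ℝ) * 4,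
    fun φ hφ hc => ?_⟩
  -- The Sobolev inequality `W^{1,1} ⊆ L²` of the plane is applied to `|φ|²`: the left side becomes
  -- `‖φ‖₄²`, and `|∇|φ|²| ≤ 2 |φ| ‖fderiv φ‖ ≤ 4 |φ| |∇φ|` is handled by Cauchy–Schwarz.
  set g : Plane → ℝ := fun x => ‖φ x‖ ^ 2 with hg
  have hgd : ContDiff ℝ 1 g := (hφ.of_le (by simp)).norm_sq ℝ
  have hgc : HasCompactSupport g := by
    refine hc.comp_left (g := fun y : Plane => ‖y‖ ^ 2) ?_
    simp
  have hfin : ((Module.finrank ℝ Plane : ℕ) : NNReal).HolderConjugate 2 := by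
    rw [finrank_euclideanSpace_fin, NNReal.holderConjugate_iff]
    refine ⟨by norm_num, ?_⟩
    rw [← NNReal.coe_inj]; push_cast; norm_num
  have hsob := eLpNorm_le_eLpNorm_fderiv_one (volume : Measure Plane) hgd hgc hfin
  have hleft : eLpNorm g ((2 : NNReal) : ENNReal) volume = eLpNorm φ 4 volume ^ 2 := by
    have h := eLpNorm_norm_rpow (p := 2) (q := 2) (μ := (volume : Measure Plane)) φ two_pos
    have h4 : (2 : ENNReal) * ENNReal.ofReal 2 = 4 := by
      rw [ENNReal.ofReal_ofNat]; norm_num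
    rw [h4] at h
    have hexp : (fun x => ‖φ x‖ ^ (2 : ℝ)) = g := by
      ext x; rw [hg]; simp
    rw [hexp] at h
    rw [ENNReal.coe_ofNat, h]
    exact_mod_cast ENNReal.rpow_natCast _ 2
  have hfd : Continuous (fderiv ℝ φ) := hφ.continuous_fderiv (by simp)
  have hjac : Continuous (jacobian φ) := by
    unfold jacobian
    refine (PiLp.continuous_toLp 2 _).comp (continuous_pi fun ij => ?_)
    exact (EuclideanSpace.proj (𝕜 := ℝ) ij.1).continuous.comp (hfd.clm_apply continuous_const)
  have hder : ∀ x, ‖fderiv ℝ g x‖ ≤ 4 * ‖‖φ x‖ * ‖jacobian φ x‖‖ := by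
    intro x
    have h := ((hφ.differentiable (by simp) x).hasFDerivAt.norm_sq).fderiv
    rw [hg, h, norm_mul, norm_norm, norm_norm]
    have h1 : ‖(innerSL ℝ (φ x)).comp (fderiv ℝ φ x)‖ ≤ ‖φ x‖ * (2 * ‖jacobian φ x‖) := by
      refine (ContinuousLinearMap.opNorm_comp_le _ _).trans ?_
      rw [innerSL_apply_norm]
      gcongr
      exact norm_fderiv_le_jacobian φ x
    rw [← Nat.cast_smul_eq_nsmul ℝ, norm_smul]
    norm_num
    linarith
  have hright : eLpNorm (fderiv ℝ g) 1 volume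
      ≤ 4 * (eLpNorm φ 2 volume * eLpNorm (jacobian φ) 2 volume) := by
    have h1 := eLpNorm_le_mul_eLpNorm_of_ae_le_mul (μ := (volume : Measure Plane)) (p := 1)
      (Eventually.of_forall hder)
    have h2 := eLpNorm_le_eLpNorm_mul_eLpNorm_of_nnnorm (μ := (volume : Measure Plane))
      (p := 2) (q := 2) (r := 1) hφ.continuous.aestronglyMeasurable hjac.aestronglyMeasurable
      (fun (a : Plane) (b : Tensor) => ‖a‖ * ‖b‖) 1 (Eventually.of_forall fun x => by simp)
    rw [ENNReal.coe_one, one_mul] at h2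
    refine h1.trans ?_
    rw [ENNReal.ofReal_ofNat]
    gcongr
  rw [← hleft]
  refine hsob.trans ?_
  push_cast
  rw [mul_assoc]
  gcongr

theorem eLpNorm_restrict_eq_of_tsupport_subset {F : Type*} [NormedAddCommGroup F] {Ω : Set Plane}
    (hΩ : IsOpen Ω) {f : Plane → F} (hf : ∀ x, x ∉ Ω → f x = 0) (p : ENNReal) :
    eLpNorm f p (volume.restrict Ω) = eLpNorm f p volume := by
  rw [← eLpNorm_indicator_eq_eLpNorm_restrict hΩ.measurableSet, indicator_eq_self.2]
  exact fun x hx => by_contra fun h => hx (hf x h)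

/-- The embedding `H¹₀ ⊆ L⁴`. -/
theorem exists_eLpNorm_four_le {Ω : Set Plane} (hΩ : IsOpen Ω) :
    ∃ K : NNReal, ∀ p ∈ H10 Ω, eLpNorm p.fst 4 (volume.restrict Ω) ≤ K * ‖p‖ₑ := by
  obtain ⟨K, hK⟩ := exists_eLpNorm_four_sq_le
  have htest : ∀ p ∈ testPairs Ω, eLpNorm p.fst 4 (volume.restrict Ω) ≤ (K + 1 : NNReal) * ‖p‖ₑ := by
    rintro p ⟨φ, h1, h2, h3, h4, h5⟩
    have hφ0 : ∀ x, x ∉ Ω → φ x = 0 := fun x hx =>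
      image_eq_zero_of_notMem_tsupport fun h => hx (h3 h)
    have hj0 : ∀ x, x ∉ Ω → jacobian φ x = 0 := by
      intro x hx
      have : fderiv ℝ φ x = 0 := image_eq_zero_of_notMem_tsupport fun h =>
        hx (h3 (tsupport_fderiv_subset ℝ h))
      ext ij
      simp [jacobian, this]
    have hfst : eLpNorm φ 2 volume ≤ ‖p‖ₑ := by
      rw [← eLpNorm_restrict_eq_of_tsupport_subset hΩ hφ0, ← eLpNorm_congr_ae h4, ← Lp.enorm_def]
      exact enorm_le_iff_norm_le.2 (WithLp.norm_fst_le (L2Vec Ω) p)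
    have hsnd : eLpNorm (jacobian φ) 2 volume ≤ ‖p‖ₑ := by
      rw [← eLpNorm_restrict_eq_of_tsupport_subset hΩ hj0, ← eLpNorm_congr_ae h5, ← Lp.enorm_def]
      exact enorm_le_iff_norm_le.2 (WithLp.norm_snd_le (L2Vec Ω) p)
    rw [eLpNorm_congr_ae h4, eLpNorm_restrict_eq_of_tsupport_subset hΩ hφ0]
    -- Comparing squares, `K ≤ (K + 1)²` avoids a square root of the constant.
    refine (ENNReal.pow_le_pow_left_iff two_ne_zero).1 ((hK φ h1 h2).trans ?_)
    calc (K : ENNReal) * (eLpNorm φ 2 volume * eLpNorm (jacobian φ) 2 volume)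
        ≤ ((K + 1 : NNReal) ^ 2 : NNReal) * (‖p‖ₑ * ‖p‖ₑ) := by
          gcongr
          nlinarith [K.2]
      _ = _ := by push_cast; ring
  refine ⟨K + 1, fun p hp => ?_⟩
  obtain ⟨P, hP, hlim⟩ := exists_seq_testPairs_tendsto hp
  have hfst : Tendsto (fun n => (P n).fst) atTop (𝓝 p.fst) :=
    ((WithLp.fstL 2 ℝ (L2Vec Ω) (L2Ten Ω)).continuous.tendsto p).comp hlim
  -- Fatou along an a.e. convergent subsequence carries the bound to the limit.
  obtain ⟨ns, hns, hae⟩ := (tendstoInMeasure_of_tendsto_Lp hfst).exists_seq_tendsto_ae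
  refine (Lp.eLpNorm_lim_le_liminf_eLpNorm
    (fun n => (Lp.aestronglyMeasurable (P (ns n)).fst)) p.fst hae).trans ?_
  refine (liminf_le_liminf (Eventually.of_forall fun n => htest _ (hP (ns n)))).trans ?_
  have hnorm : Tendsto (fun n => ((K + 1 : NNReal) : ENNReal) * ‖P (ns n)‖ₑ) atTop
      (𝓝 ((K + 1 : NNReal) * ‖p‖ₑ)) :=
    ENNReal.Tendsto.const_mul ((continuous_enorm.tendsto p).comp (hlim.comp hns.tendsto_atTop))
      (Or.inr ENNReal.coe_ne_top)
  exact hnorm.liminf_eq.le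

/-! ### Vanishing of the convective term -/

/-- The tensor with entries `c i * a j`. -/
noncomputable def outer (a c : Plane) : Tensor := WithLp.toLp 2 fun ij => c ij.1 * a ij.2

theorem norm_outer (a c : Plane) : ‖outer a c‖ = ‖a‖ * ‖c‖ := by
  rw [← sq_eq_sq₀ (norm_nonneg _) (by positivity), mul_pow, EuclideanSpace.norm_sq_eq,
    EuclideanSpace.norm_sq_eq, EuclideanSpace.norm_sq_eq, Fintype.sum_prod_type]
  simp only [outer, norm_mul, mul_pow, Fin.sum_univ_two]
  ring

theorem outer_sub (a c d : Plane) : outer a (c - d) = outer a c - outer a d := by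
  ext ij
  simp [outer, sub_mul]

theorem continuous_outer : Continuous fun z : Plane × Plane => outer z.1 z.2 := by
  unfold outer
  fun_prop

theorem inner_outer (A : Tensor) (a c : Plane) :
    inner ℝ A (outer a c) = ∑ i, (∑ j, a j * A (i, j)) * c i := by
  rw [inner_tensor]
  refine Finset.sum_congr rfl fun i _ => ?_
  rw [Finset.sum_mul]
  exact Finset.sum_congr rfl fun j _ => by simp only [outer]; ring

theorem eLpNorm_outer_le {α : Type*} [MeasurableSpace α] {ν : Measure α} {a c : α → Plane}
    (ha : AEStronglyMeasurable a ν) (hc : AEStronglyMeasurable c ν) :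
    eLpNorm (fun x => outer (a x) (c x)) 2 ν ≤ eLpNorm a 4 ν * eLpNorm c 4 ν := by
  have : ENNReal.HolderTriple 4 4 2 := ⟨by
    rw [← two_mul, show (4 : ENNReal) = 2 * 2 by norm_num,
      ENNReal.mul_inv (Or.inl two_ne_zero) (Or.inl ENNReal.ofNat_ne_top), ← mul_assoc,
      ENNReal.mul_inv_cancel two_ne_zero ENNReal.ofNat_ne_top, one_mul]⟩
  have h := eLpNorm_le_eLpNorm_mul_eLpNorm_of_nnnorm (p := 4) (q := 4) (r := 2) ha hc outer 1
    (Eventually.of_forall fun x => by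
      rw [one_mul, ← NNReal.coe_le_coe]
      push_cast
      exact (norm_outer _ _).le)
  rwa [ENNReal.coe_one, one_mul] at h

/-- `∫_Ω (v · ∇) φ · φ = ∫_Ω v · ∇ (|φ|² / 2) = 0` for a test field `φ`. -/
theorem integral_inner_outer_test {Ω : Set Plane} (hΩ : IsOpen Ω) (v : V Ω) {φ : Plane → Plane}
    (hφ : ContDiff ℝ ∞ φ) (hc : HasCompactSupport φ) :
    ∫ x in Ω, inner ℝ (jacobian φ x) (outer (field v x) (φ x)) = 0 := by
  set q : Plane → ℝ := fun x => ‖φ x‖ ^ 2 with hq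
  have hqd : ContDiff ℝ ∞ q := hφ.norm_sq ℝ
  have hqc : HasCompactSupport q := by
    refine hc.comp_left (g := fun y : Plane => ‖y‖ ^ 2) ?_
    simp
  have hgc : Continuous (gradient q) :=
    (InnerProductSpace.toDual ℝ Plane).symm.continuous.comp (hqd.continuous_fderiv (by simp))
  have hgs : HasCompactSupport (gradient q) :=
    (hqc.fderiv (𝕜 := ℝ)).comp_left (g := (InnerProductSpace.toDual ℝ Plane).symm) (map_zero _)
  have hgm : MemLp (gradient q) 2 (volume.restrict Ω) := hgc.memLp_of_hasCompactSupport hgs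
  have h := inner_field_eq_zero hΩ (g := hgm.toLp)
    ⟨q, hqd.contDiffOn, hqd.continuous.memLp_of_hasCompactSupport hqc, hgm.coeFn_toLp⟩ v
  rw [L2.inner_def] at h
  have h2 : ∫ x in Ω, inner ℝ ((hgm.toLp (gradient q) : L2Vec Ω) x) (field v x)
      = 2 * ∫ x in Ω, inner ℝ (jacobian φ x) (outer (field v x) (φ x)) := by
    rw [← integral_const_mul]
    refine integral_congr_ae ?_
    filter_upwards [hgm.coeFn_toLp] with x hx
    have hd := ((hφ.differentiable (by simp) x).hasFDerivAt.norm_sq).fderiv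
    rw [hx, inner_gradient_eq, hq, hd, inner_outer]
    simp only [smul_apply, ContinuousLinearMap.comp_apply, innerSL_apply_apply, nsmul_eq_mul,
      inner_plane, fderiv_apply_eq_sum_jacobian]
    push_cast
    congr 1
    exact Finset.sum_congr rfl fun i _ => mul_comm _ _
  linarith

/-- The convective term vanishes on the diagonal. -/
theorem convection_self {Ω : Set Plane} (hΩ : IsOpen Ω) (v : V Ω) : convection v v v = 0 := by
  obtain ⟨K, hK⟩ := exists_eLpNorm_four_le hΩ
  have hmeas : ∀ p : L2Pair Ω, AEStronglyMeasurable (fun x => outer (field v x) (p.fst x))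
      (volume.restrict Ω) := fun p =>
    continuous_outer.comp_aestronglyMeasurable
      ((Lp.aestronglyMeasurable (field v)).prodMk (Lp.aestronglyMeasurable p.fst))
  have hle : ∀ p ∈ H10 Ω, eLpNorm (fun x => outer (field v x) (p.fst x)) 2 (volume.restrict Ω)
      ≤ K * ‖(v : L2Pair Ω)‖ₑ * (K * ‖p‖ₑ) := fun p hp =>
    (eLpNorm_outer_le (Lp.aestronglyMeasurable _) (Lp.aestronglyMeasurable _)).trans
      (mul_le_mul' (hK _ v.2.1) (hK p hp))
  have hfin : ∀ p : L2Pair Ω, (K : ENNReal) * ‖(v : L2Pair Ω)‖ₑ * (K * ‖p‖ₑ) ≠ ⊤ := fun p =>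
    ENNReal.mul_ne_top (ENNReal.mul_ne_top ENNReal.coe_ne_top enorm_ne_top)
      (ENNReal.mul_ne_top ENNReal.coe_ne_top enorm_ne_top)
  have hmem : ∀ p ∈ H10 Ω, MemLp (fun x => outer (field v x) (p.fst x)) 2 (volume.restrict Ω) :=
    fun p hp => ⟨hmeas p, (hle p hp).trans_lt (hfin p).lt_top⟩
  -- The transporting field stays equal to `v`, which keeps it divergence free; only the other two
  -- slots are approximated, by test fields that need not be divergence free. Gradients converge in
  -- `L²`, and so do the products `outer v φ` by the `L⁴` bound.
  obtain ⟨P, hP, hlim⟩ := exists_seq_testPairs_tendsto v.2.1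
  have hPH : ∀ n, P n ∈ H10 Ω := fun n =>
    Submodule.le_topologicalClosure _ (Submodule.subset_span (hP n))
  have hlimT : Tendsto (fun n => (hmem _ (hPH n)).toLp) atTop (𝓝 (hmem _ v.2.1).toLp) := by
    rw [tendsto_iff_edist_tendsto_0]
    have h0 : Tendsto (fun n => (K : ENNReal) * ‖(v : L2Pair Ω)‖ₑ * (K * ‖P n - v‖ₑ)) atTop
        (𝓝 0) := by
      have h1 : Tendsto (fun n => ‖P n - (v : L2Pair Ω)‖ₑ) atTop (𝓝 0) := by
        have := tendsto_iff_edist_tendsto_0.1 hlim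
        simpa only [edist_eq_enorm_sub] using this
      have h2 := ENNReal.Tendsto.const_mul (a := (K : ENNReal) * ‖(v : L2Pair Ω)‖ₑ)
        (ENNReal.Tendsto.const_mul (a := (K : ENNReal)) h1 (Or.inr ENNReal.coe_ne_top))
        (Or.inr (ENNReal.mul_ne_top ENNReal.coe_ne_top enorm_ne_top))
      simpa using h2
    refine tendsto_of_tendsto_of_tendsto_of_le_of_le tendsto_const_nhds h0 (fun _ => zero_le)
      fun n => ?_
    rw [Lp.edist_toLp_toLp]
    refine le_trans (le_of_eq (eLpNorm_congr_ae ?_)) (hle _ ((H10 Ω).sub_mem (hPH n) v.2.1))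
    filter_upwards [Lp.coeFn_sub (P n).fst (v : L2Pair Ω).fst] with x hx
    have hx' : (P n - (v : L2Pair Ω)).fst x = (P n).fst x - (v : L2Pair Ω).fst x := hx
    rw [hx', outer_sub]
    rfl
  have hsnd : Tendsto (fun n => (P n).snd) atTop (𝓝 (v : L2Pair Ω).snd) :=
    ((WithLp.sndL 2 ℝ (L2Vec Ω) (L2Ten Ω)).continuous.tendsto _).comp hlim
  have hzero : ∀ n, inner ℝ (P n).snd (hmem _ (hPH n)).toLp = 0 := by
    intro n
    obtain ⟨φ, h1, h2, h3, h4, h5⟩ := hP n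
    rw [L2.inner_def, ← integral_inner_outer_test hΩ v h1 h2]
    refine integral_congr_ae ?_
    filter_upwards [(hmem _ (hPH n)).coeFn_toLp, h4, h5] with x e1 e2 e3
    rw [e1, e2, e3]
  have hinner := hsnd.inner (𝕜 := ℝ) hlimT
  simp only [hzero] at hinner
  have hval := tendsto_nhds_unique hinner tendsto_const_nhds
  rw [L2.inner_def] at hval
  rw [convection, ← hval]
  refine integral_congr_ae ?_
  filter_upwards [(hmem _ v.2.1).coeFn_toLp] with x hx
  rw [hx, inner_outer]
  rfl

/-! ### Integrability of the stress power -/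

/-- `symPart` as a continuous linear map. -/
noncomputable def symPartL : Tensor →L[ℝ] Tensor :=
  LinearMap.toContinuousLinearMap
    { toFun := symPart
      map_add' := fun A B => by ext ij; simp only [symPart, PiLp.add_apply]; ring
      map_smul' := fun c A => by
        ext ij; simp only [symPart, PiLp.smul_apply, smul_eq_mul, RingHom.id_apply]; ring }

/-- The strain as an element of `L²`. -/
noncomputable def strainL (Ω : Set Plane) : V Ω →L[ℝ] L2Ten Ω :=
  (symPartL.compLpL 2 (volume.restrict Ω)).comp
    ((WithLp.sndL 2 ℝ (L2Vec Ω) (L2Ten Ω)).comp (V Ω).subtypeL)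

theorem strainL_ae_eq {Ω : Set Plane} (v : V Ω) :
    strainL Ω v =ᵐ[volume.restrict Ω] strain v :=
  symPartL.coeFn_compLpL (grad v)

theorem stressPower_eq_inner {Ω : Set Plane} {σ : Plane → Tensor}
    (hσ : MemLp σ 2 (volume.restrict Ω)) (v : V Ω) :
    stressPower σ v = inner ℝ (hσ.toLp σ) (strainL Ω v) := by
  rw [L2.inner_def, stressPower]
  refine integral_congr_ae ?_
  filter_upwards [hσ.coeFn_toLp, strainL_ae_eq v] with x h1 h2
  rw [h1, h2]

theorem stressPower_zero {Ω : Set Plane} (σ : Plane → Tensor) :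
    stressPower σ (0 : V Ω) = 0 := by
  refine integral_eq_zero_of_ae ?_
  filter_upwards [strainL_ae_eq (0 : V Ω), Lp.coeFn_zero Tensor 2 (volume.restrict Ω)] with x h1 h2
  rw [← h1, map_zero, h2]
  exact inner_zero_right _

theorem convection_zero_right {Ω : Set Plane} (a b : V Ω) : convection a b 0 = 0 := by
  refine integral_eq_zero_of_ae ?_
  filter_upwards [Lp.coeFn_zero Plane 2 (volume.restrict Ω)] with x hx
  have h : field (0 : V Ω) x = 0 := hx
  simp [h]

theorem abs_stressPower_le {Ω : Set Plane} {σ : Plane → Tensor}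
    (hσ : MemLp σ 2 (volume.restrict Ω)) (v : V Ω) :
    |stressPower σ v| ≤ (∫ x in Ω, ‖σ x‖ ^ 2) + ‖strainL Ω‖ ^ 2 * ‖v‖ ^ 2 := by
  have hn : ‖hσ.toLp σ‖ ^ 2 = ∫ x in Ω, ‖σ x‖ ^ 2 := by
    rw [← real_inner_self_eq_norm_sq, L2.inner_def]
    refine integral_congr_ae ?_
    filter_upwards [hσ.coeFn_toLp] with x hx
    rw [hx, real_inner_self_eq_norm_sq]
  rw [stressPower_eq_inner hσ, ← hn, ← mul_pow]
  have h1 := abs_real_inner_le_norm (hσ.toLp σ) (strainL Ω v)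
  have h2 := (strainL Ω).le_opNorm v
  have h3 := two_mul_le_add_sq ‖hσ.toLp σ‖ (‖strainL Ω‖ * ‖v‖)
  have h4 : ‖hσ.toLp σ‖ * ‖strainL Ω v‖ ≤ ‖hσ.toLp σ‖ * (‖strainL Ω‖ * ‖v‖) := by gcongr
  nlinarith [sq_nonneg ‖hσ.toLp σ‖, sq_nonneg (‖strainL Ω‖ * ‖v‖)]

/-- A Carathéodory function composed with a measurable function is measurable. -/
theorem aestronglyMeasurable_caratheodory {α X : Type*} [MeasurableSpace α] {ν : Measure α}
    [NormedAddCommGroup X] {F : α → X → ℝ} (hF : ∀ v, AEStronglyMeasurable (fun t => F t v) ν)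
    (hFc : ∀ᵐ t ∂ν, Continuous (F t)) {u : α → X} (hu : AEStronglyMeasurable u ν) :
    AEStronglyMeasurable (fun t => F t (u t)) ν := by
  have hs := hu.stronglyMeasurable_mk
  refine aestronglyMeasurable_of_tendsto_ae atTop (f := fun n t => F t (hs.approx n t))
    (fun n => ?_) ?_
  -- A simple function takes finitely many values, so the composition splits into functions `F · v`
  -- with `v` frozen on measurable pieces.
  · have hsum : (fun t => F t (hs.approx n t)) = fun t => ∑ v ∈ (hs.approx n).range,
        ((hs.approx n) ⁻¹' {v}).indicator (fun t => F t v) t := by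
      ext t
      rw [Finset.sum_eq_single (hs.approx n t)]
      · rw [indicator_of_mem (by simp)]
      · intro v _ hv
        exact indicator_of_notMem (fun h => hv h.symm) _
      · exact fun h => absurd (SimpleFunc.mem_range_self _ t) h
    rw [hsum]
    exact Finset.aestronglyMeasurable_fun_sum _ fun v _ =>
      (hF v).indicator ((hs.approx n).measurableSet_fiber v)
  · filter_upwards [hFc, hu.ae_eq_mk] with t h1 h2
    rw [h2]
    exact (h1.tendsto _).comp (hs.tendsto_approx t)

/-- By Fubini almost every slice of `τ` is in `L²(Ω)`. The power is then continuous in the `V`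
argument and measurable in time, and it is dominated by the squared norms of `τ t` and `u t`. -/
theorem integrable_stressPower {Ω : Set Plane} {T : ℝ} {τ : ℝ → Plane → Tensor}
    (hτ : MemLp (fun z : ℝ × Plane => τ z.1 z.2) 2 (volume.restrict (Ioo 0 T ×ˢ Ω)))
    {u : ℝ → V Ω} (hu : MemL2Time T u) :
    Integrable (fun t => stressPower (τ t) (u t)) (volume.restrict (Ioo 0 T)) := by
  rw [Measure.volume_eq_prod, ← Measure.prod_restrict] at hτ
  have hsq := (memLp_two_iff_integrable_sq_norm hτ.1).1 hτ
  have hslice : ∀ᵐ t ∂(volume.restrict (Ioo 0 T)), MemLp (τ t) 2 (volume.restrict Ω) := by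
    filter_upwards [hτ.1.prodMk_left, hsq.prod_right_ae] with t h1 h2
    exact (memLp_two_iff_integrable_sq_norm h1).2 h2
  have hmeas : AEStronglyMeasurable (fun t => stressPower (τ t) (u t))
      (volume.restrict (Ioo 0 T)) := by
    refine aestronglyMeasurable_caratheodory (F := fun t v => stressPower (τ t) v)
      (fun v => ?_) ?_ hu.1
    · have hv : AEStronglyMeasurable (strain v) (volume.restrict Ω) :=
        (Lp.aestronglyMeasurable (strainL Ω v)).congr (strainL_ae_eq v)
      exact (hτ.1.inner (𝕜 := ℝ) hv.comp_snd).integral_prod_right'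
    · filter_upwards [hslice] with t ht
      simp only [stressPower_eq_inner ht]
      fun_prop
  have hu2 : Integrable (fun t => ‖u t‖ ^ 2) (volume.restrict (Ioo 0 T)) :=
    MemLp.integrable_norm_pow hu (by norm_num)
  refine (hsq.integral_prod_left.add (hu2.const_mul (‖strainL Ω‖ ^ 2))).mono' hmeas ?_
  filter_upwards [hslice] with t ht
  exact abs_stressPower_le ht (u t)

/-! ### Energy balance and conclusion -/

theorem intervalIntegrable_of_integrable_Ioo {T : ℝ} (hT : 0 < T) {g : ℝ → ℝ}
    (hg : Integrable g (volume.restrict (Ioo 0 T))) : IntervalIntegrable g volume 0 T :=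
  (intervalIntegrable_iff_integrableOn_Ioo_of_le hT.le).2 hg

theorem intervalIntegral_indicator_Ioc {T s₁ s₂ : ℝ} (h1 : 0 ≤ s₁) (h12 : s₁ ≤ s₂) (h2 : s₂ ≤ T)
    (g : ℝ → ℝ) : ∫ t in 0..T, (Ioc s₁ s₂).indicator g t = ∫ t in s₁..s₂, g t := by
  rw [intervalIntegral.integral_of_le (h1.trans (h12.trans h2)),
    setIntegral_indicator measurableSet_Ioc, intervalIntegral.integral_of_le h12,
    inter_eq_self_of_subset_right (Ioc_subset_Ioc h1 h2)]

/-- Every right neighbourhood of `0` has positive measure. Without this the weak initial condition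
would not determine a limit. -/
theorem neBot_nhdsGT_inf_ae : (𝓝[>] (0 : ℝ) ⊓ ae volume).NeBot := by
  rw [inf_neBot_iff]
  intro s hs t ht
  obtain ⟨ε, hε, hsub⟩ := mem_nhdsGT_iff_exists_Ioo_subset.1 hs
  by_contra hne
  have hle : Ioo 0 ε ⊆ tᶜ := fun x hx hxt => hne ⟨x, hsub hx, hxt⟩
  have h0 : volume (Ioo 0 ε) = 0 := measure_mono_null hle (mem_ae_iff.1 ht)
  rw [Real.volume_Ioo, sub_zero, ENNReal.ofReal_eq_zero] at h0
  exact absurd hε (not_lt.2 h0)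

/-- The balance of energy between two times, in terms of the duality bracket of `∂ₜu` and `u`. -/
theorem integral_timeDeriv_add_stressPower {Ω : Set Plane} (hΩ : IsOpen Ω) {T : ℝ}
    {f : ℝ → VDual Ω} {u : ℝ → V Ω} {τ : ℝ → Plane → Tensor} {w : ℝ → VDual Ω}
    (hu : MemL2Time T u)
    (hform : ∀ φ : ℝ → V Ω, MemL2Time T φ →
      (∫ t in 0..T, w t (φ t)) + (∫ t in 0..T, stressPower (τ t) (φ t))
        + (∫ t in 0..T, convection (u t) (u t) (φ t)) = ∫ t in 0..T, f t (φ t))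
    {s₁ s₂ : ℝ} (h1 : s₁ ∈ Icc 0 T) (h2 : s₂ ∈ Icc 0 T) :
    (∫ t in s₁..s₂, w t (u t)) + (∫ t in s₁..s₂, stressPower (τ t) (u t))
      = ∫ t in s₁..s₂, f t (u t) := by
  wlog h12 : s₁ ≤ s₂ generalizing s₁ s₂
  · have h := this h2 h1 (le_of_not_ge h12)
    rw [intervalIntegral.integral_symm s₂ s₁, intervalIntegral.integral_symm s₂ s₁,
      intervalIntegral.integral_symm s₂ s₁, ← h]
    ring
  have h := hform ((Ioc s₁ s₂).indicator u) (MemLp.indicator measurableSet_Ioc hu)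
  -- Every term vanishes when the test field does, so the cutoff of `u` passes to the integrand. In
  -- the convective term only the last slot is cut off.
  have hind : ∀ F : ℝ → V Ω → ℝ, (∀ t, F t 0 = 0) →
      ∫ t in 0..T, F t ((Ioc s₁ s₂).indicator u t) = ∫ t in s₁..s₂, F t (u t) := by
    intro F hF
    rw [← intervalIntegral_indicator_Ioc h1.1 h12 h2.2]
    refine intervalIntegral.integral_congr fun t _ => ?_
    by_cases ht : t ∈ Ioc s₁ s₂
    · simp only [indicator_of_mem ht]
    · simp only [indicator_of_notMem ht, hF]
  rw [hind (fun t v => w t v) fun t => map_zero _,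
    hind (fun t v => stressPower (τ t) v) fun t => stressPower_zero _,
    hind (fun t v => convection (u t) (u t) v) fun t => convection_zero_right _ _,
    hind (fun t v => f t v) fun t => map_zero _] at h
  simpa only [convection_self hΩ, intervalIntegral.integral_zero, add_zero] using h

end BinghamFlow

theorem mainTheorem6 (Ω : Set BinghamFlow.Plane) (hΩ : IsOpen Ω) (T μ τy : ℝ) (hT : 0 < T)
    (hμ : 0 < μ) (hτy : 0 ≤ τy) (f : ℝ → BinghamFlow.VDual Ω) (hf : BinghamFlow.MemL2Time T f)
    (u₀ : BinghamFlow.H Ω) (u : ℝ → BinghamFlow.V Ω)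
    (τ : ℝ → BinghamFlow.Plane → BinghamFlow.Tensor)
    (hu : BinghamFlow.IsWeakSolution T μ τy f u₀ u τ) :
    ∃ U : ℝ → BinghamFlow.H Ω,
      ContinuousOn U (Icc 0 T) ∧
      (∀ᵐ t ∂(volume.restrict (Ioo 0 T)), (U t : BinghamFlow.L2Vec Ω) = BinghamFlow.field (u t)) ∧
      U 0 = u₀ ∧
      IntervalIntegrable (fun t => BinghamFlow.stressPower (τ t) (u t)) volume 0 T ∧
      IntervalIntegrable (fun t => f t (u t)) volume 0 T ∧
      ∀ s₁ ∈ Icc 0 T, ∀ s₂ ∈ Icc 0 T,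
        1 / 2 * ‖U s₂‖ ^ 2 + (∫ t in s₁..s₂, BinghamFlow.stressPower (τ t) (u t))
          = (∫ t in s₁..s₂, f t (u t)) + 1 / 2 * ‖U s₁‖ ^ 2 := by
  obtain ⟨w, hw, hform⟩ := hu.weak_form
  have huL : MemLp u 2 (volume.restrict (Ioo 0 T)) := hw.memL2
  let j : BinghamFlow.V Ω →L[ℝ] BinghamFlow.L2Vec Ω :=
    (WithLp.fstL 2 ℝ (BinghamFlow.L2Vec Ω) (BinghamFlow.L2Ten Ω)).comp (BinghamFlow.V Ω).subtypeL
  obtain ⟨W, hWc, hWu, hWcl, hWen⟩ := BinghamFlow.exists_continuous_representative j hT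
    huL hw.memL2_deriv hw.deriv_eq
  have hWH : ∀ t ∈ Icc 0 T, W t ∈ BinghamFlow.H Ω := by
    intro t ht
    refine closure_minimal ?_ (Submodule.isClosed_orthogonal _) (hWcl t ht)
    rintro _ ⟨v, rfl⟩
    exact BinghamFlow.field_mem_H hΩ v
  classical
  -- The default value `0` can occur only outside `[0, T]`.
  obtain ⟨U, hU⟩ : ∃ U : ℝ → BinghamFlow.H Ω, ∀ t ∈ Icc 0 T, (U t : BinghamFlow.L2Vec Ω) = W t :=
    ⟨fun t => if h : W t ∈ BinghamFlow.H Ω then ⟨W t, h⟩ else 0, fun t ht => by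
      simp only [dif_pos (hWH t ht)]⟩
  have hUc : ContinuousOn U (Icc 0 T) :=
    IsInducing.subtypeVal.continuousOn_iff.2 (hWc.congr hU)
  have hUu : ∀ᵐ t ∂(volume.restrict (Ioo 0 T)),
      (U t : BinghamFlow.L2Vec Ω) = BinghamFlow.field (u t) := by
    filter_upwards [hWu, ae_restrict_mem measurableSet_Ioo] with t h1 h2
    rw [hU t (Ioo_subset_Icc_self h2), h1]
    rfl
  refine ⟨U, hUc, hUu, ?_, ?_, ?_, ?_⟩
  -- Against a fixed `h` in `H`, the continuous representative and the weak initial condition give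
  -- two limits along the same nontrivial filter.
  · refine ext_inner_right ℝ fun h => ?_
    have := BinghamFlow.neBot_nhdsGT_inf_ae
    refine tendsto_nhds_unique ?_ (hu.initial h)
    have hU0 : Tendsto U (𝓝[>] 0) (𝓝 (U 0)) := by
      rw [← nhdsWithin_Ioo_eq_nhdsGT hT]
      exact (hUc 0 ⟨le_rfl, hT.le⟩).mono_left (nhdsWithin_mono _ Ioo_subset_Icc_self)
    have hlim : Tendsto (fun t => inner ℝ (U t) h) (𝓝[>] (0 : ℝ) ⊓ ae volume)
        (𝓝 (inner ℝ (U 0) h)) :=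
      (hU0.inner (𝕜 := ℝ) tendsto_const_nhds).mono_left inf_le_left
    refine hlim.congr' ?_
    rw [ae_restrict_iff' measurableSet_Ioo] at hUu
    filter_upwards [mem_inf_of_left (Ioo_mem_nhdsGT hT), mem_inf_of_right hUu] with t h1 h2
    rw [← h2 h1]
    rfl
  · exact BinghamFlow.intervalIntegrable_of_integrable_Ioo hT
      (BinghamFlow.integrable_stressPower hu.stress_memL2 hw.memL2)
  · exact BinghamFlow.intervalIntegrable_of_integrable_Ioo hT
      (BinghamFlow.integrable_dual_apply hf huL)
  · intro s₁ h1 s₂ h2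
    have e1 := BinghamFlow.integral_timeDeriv_add_stressPower hΩ hw.memL2 hform h1 h2
    have e2 := hWen s₁ h1 s₂ h2
    rw [← hU s₁ h1, ← hU s₂ h2] at e2
    change ‖U s₂‖ ^ 2 - ‖U s₁‖ ^ 2 = _ at e2
    linarith
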